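/- Conventions. Signatures consist of function and predicate symbols with arities (equality is logical); they are effectively presented, i.e. the symbols are numbered and arities are computable, so that formulas have Gödel numbers. A theory $\mathcal T$ is the class of all interpretations (non-empty structures together with values for the variables) satisfying a set $\mathrm{Ax}(\mathcal T)$ of sentences. $\mathcal T$ is *decidable* if the set of $\mathcal T$-satisfiable quantifier-free formulas is decidable. $\mathcal T$ is *smooth* if for every quantifier-free $\varphi$, every $\mathcal T$-interpretation $\mathcal A$ satisfying $\varphi$ and every cardinal $\kappa>|\mathcal A|$ there is a $\mathcal T$-interpretation of cardinality $\kappa$ satisfying $\varphi$. $\mathcal T$ has the *finite model property* if every $\mathcal T$-satisfiable quantifier-free formula is satisfied by a finite $\mathcal T$-interpretation. For theories over disjoint signatures, $\mathcal T_1\oplus\mathcal T_2$ is the theory over the union of the signatures axiomatized by $\mathrm{Ax}(\mathcal T_1)\cup\mathrm{Ax}(\mathcal T_2)$. Let $\Sigma_P$ be the signature with $0$-ary predicate symbols $P_1,P_2,\dots$ only, and let $\mathcal T_=$ be the $\Sigma_P$-theory axiomatized by $P_n\to$ "there are exactly $n$ elements" for all $n\ge 1$. Let $\Sigma_s$ be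 the signature with one unary function symbol $s$ only. Call $f:\{1,2,3,\dots\}\to\{0,1\}$ *admissible* if it is not computable, $f(1)=1$, and for every $k\ge 1$ exactly half of the numbers $1,\dots,2^k$ are mapped to $1$. Let $f_i(k)$ be the number of $j\in\{1,\dots,k\}$ with $f(j)=i$. Let $\mathcal T_f$ be the $\Sigma_s$-theory axiomatized, for all $k\ge 1$, by $$\bigl[\psi^{=}_{\ge f_1(k)}\wedge\psi^{\ne}_{\ge f_0(k)}\bigr]\vee\bigvee_{i=1}^{k}\bigl[\psi^{=}_{=f_1(i)}\wedge\psi^{\ne}_{=f_0(i)}\bigr],$$ where $\psi^{=}_{\ge n}$ and $\psi^{=}_{=n}$ say that at least, respectively exactly, $n$ elements $x$ satisfy $s(x)=x$, and $\psi^{\ne}_{\ge n}$, $\psi^{\ne}_{=n}$ say the same of $s(x)\neq x$. **Theorem.** 1. There are decidable theories $\mathcal T_1$ and $\mathcal T_2$ over disjoint signatures such that $\mathcal T_2$ is smooth and has the finite model property, but $\mathcal T_1\oplus\mathcal T_2$ is undecidable. 2. Admissible functions exist, and for every admissible $f$ the theories $\mathcal T_1=\mathcal T_=$ and $\mathcal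 T_2=\mathcal T_f$ are such: $\mathcal T_=$ and $\mathcal T_f$ are decidable, $\mathcal T_f$ is smooth and has the finite model property, and $\mathcal T_=\oplus\mathcal T_f$ is undecidable. (So in the theorem that $\mathcal T_1\oplus\mathcal T_2$ is decidable whenever $\mathcal T_1$ and $\mathcal T_2$ are decidable theories over disjoint signatures and $\mathcal T_2$ is smooth, has the finite model property and has a computable minimal model function, the last assumption cannot be dropped.) -/

import Mathlib

universe u

namespace TheoryCombination

open FirstOrder FirstOrder.Language Cardinal

/-! ### Effectively presented signatures and Gödel numbers of formulas -/

/-- An effectively presented (countable) signature: the function and predicate symbols are coded by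
natural numbers, and the arity of a symbol is computable from its code. Equality is a logical
symbol of `FirstOrder.Language`. -/
class EffectiveSignature (L : FirstOrder.Language.{0, 0}) where
  /-- A numbering of the function symbols. -/
  codeFunctions : Primcodable (Σ n, L.Functions n)
  /-- A numbering of the predicate symbols. -/
  codeRelations : Primcodable (Σ n, L.Relations n)
  computable_functionArity : Computable fun F : (Σ n, L.Functions n) => F.1
  computable_relationArity : Computable fun R : (Σ n, L.Relations n) => R.1

attribute [instance, reducible] EffectiveSignature.codeFunctions EffectiveSignature.codeRelations

/-- The disjoint union of two effectively presented signatures is effectively presented: codes of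
the symbols of the union are codes of elements of the sum of the two symbol types. -/
instance EffectiveSignature.sum (L₁ L₂ : FirstOrder.Language.{0, 0}) [EffectiveSignature L₁]
    [EffectiveSignature L₂] : EffectiveSignature (L₁.sum L₂) :=
  letI eF : (Σ n, (L₁.sum L₂).Functions n) ≃ (Σ n, L₁.Functions n) ⊕ (Σ n, L₂.Functions n) :=
    Equiv.sigmaSumDistrib L₁.Functions L₂.Functions
  letI eR : (Σ n, (L₁.sum L₂).Relations n) ≃ (Σ n, L₁.Relations n) ⊕ (Σ n, L₂.Relations n) :=
    Equiv.sigmaSumDistrib L₁.Relations L₂.Relations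
  letI iF : Primcodable (Σ n, (L₁.sum L₂).Functions n) := Primcodable.ofEquiv _ eF
  letI iR : Primcodable (Σ n, (L₁.sum L₂).Relations n) := Primcodable.ofEquiv _ eR
  { codeFunctions := iF
    codeRelations := iR
    computable_functionArity := by
      have he : Computable eF := Primrec.of_equiv.to_comp
      refine (Computable.sumCasesOn he
        (EffectiveSignature.computable_functionArity.comp Computable.snd).to₂
        (EffectiveSignature.computable_functionArity.comp Computable.snd).to₂).of_eq ?_
      rintro ⟨n, F | F⟩ <;> rfl
    computable_relationArity := by
      have he : Computable eR := Primrec.of_equiv.to_comp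
      refine (Computable.sumCasesOn he
        (EffectiveSignature.computable_relationArity.comp Computable.snd).to₂
        (EffectiveSignature.computable_relationArity.comp Computable.snd).to₂).of_eq ?_
      rintro ⟨n, R | R⟩ <;> rfl }

/-- The Gödel number of a term. -/
def termCode {L : FirstOrder.Language.{0, 0}} [EffectiveSignature L] {α : Type} [Encodable α] :
    L.Term α → ℕ
  | .var x => Nat.pair 0 (Encodable.encode x)
  | .func F ts => Nat.pair 1 (Nat.pair
      (Encodable.encode (⟨_, F⟩ : Σ n, L.Functions n))
      (Encodable.encode (List.ofFn fun i => termCode (ts i))))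

/-- The Gödel number of a formula. -/
def formulaCode {L : FirstOrder.Language.{0, 0}} [EffectiveSignature L] {α : Type} [Encodable α] :
    ∀ {n : ℕ}, L.BoundedFormula α n → ℕ
  | _, .falsum => Nat.pair 0 0
  | _, .equal t₁ t₂ => Nat.pair 1 (Nat.pair (termCode t₁) (termCode t₂))
  | _, .rel R ts => Nat.pair 2 (Nat.pair
      (Encodable.encode (⟨_, R⟩ : Σ n, L.Relations n))
      (Encodable.encode (List.ofFn fun i => termCode (ts i))))
  | _, .imp φ ψ => Nat.pair 3 (Nat.pair (formulaCode φ) (formulaCode ψ))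
  | _, .all φ => Nat.pair 4 (formulaCode φ)

theorem termCode_injective {L : FirstOrder.Language.{0, 0}} [EffectiveSignature L] {α : Type} [Encodable α] :
    Function.Injective (termCode : L.Term α → ℕ) := by
  intro t
  induction t with
  | var x =>
    rintro (y | ⟨G, us⟩) h <;> simp [termCode, Nat.pair_eq_pair] at h ⊢
    exact h
  | func F ts ih =>
    rintro (y | ⟨G, us⟩) h <;> simp [termCode, Nat.pair_eq_pair] at h
    obtain ⟨⟨rfl, h₁⟩, h₂⟩ := h
    obtain rfl := eq_of_heq h₁
    rw [List.ofFn_inj] at h₂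
    congr 1
    funext i
    exact ih i (congrFun h₂ i)

theorem formulaCode_injective {L : FirstOrder.Language.{0, 0}} [EffectiveSignature L] {α : Type}
    [Encodable α] {n : ℕ} : Function.Injective (formulaCode : L.BoundedFormula α n → ℕ) := by
  intro φ
  induction φ with
  | falsum => intro ψ h; cases ψ <;> simp [formulaCode, Nat.pair_eq_pair] at h ⊢
  | equal t₁ t₂ =>
    intro ψ h
    cases ψ <;> simp [formulaCode, Nat.pair_eq_pair, termCode_injective.eq_iff] at h ⊢
    exact h
  | rel R ts =>
    intro ψ h
    cases ψ with
    | rel S us =>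
      simp only [formulaCode, Nat.pair_eq_pair, Encodable.encode_inj, Sigma.mk.injEq,
        true_and] at h
      obtain ⟨⟨rfl, h₁⟩, h₂⟩ := h
      obtain rfl := eq_of_heq h₁
      rw [List.ofFn_inj] at h₂
      congr 1
      funext i
      exact termCode_injective (congrFun h₂ i)
    | _ => simp [formulaCode, Nat.pair_eq_pair] at h
  | imp φ₁ φ₂ ih₁ ih₂ =>
    intro ψ h
    cases ψ <;> simp [formulaCode, Nat.pair_eq_pair] at h ⊢
    exact ⟨ih₁ h.1, ih₂ h.2⟩
  | all φ ih =>
    intro ψ h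
    cases ψ <;> simp [formulaCode, Nat.pair_eq_pair] at h ⊢
    exact ih h

/-! ### Interpretations and properties of theories

A theory is given by its axiomatization `T : L.Theory`. Formulas have variables in `ℕ`. An
interpretation is a domain `A`, an `L`-structure on `A`, and a value `v x : A` for each variable
`x`; in particular `A` is nonempty. -/

/-- `φ` is `T`-satisfiable: some `T`-interpretation satisfies `φ`. -/
def Satisfiable {L : FirstOrder.Language.{0, 0}} (T : L.Theory) (φ : L.Formula ℕ) : Prop :=
  ∃ (A : Type u) (_ : L.Structure A) (v : ℕ → A), A ⊨ T ∧ φ.Realize v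

/-- `T` is decidable: there is an algorithm that, given (the Gödel number of) a quantifier-free
formula, decides whether it is `T`-satisfiable. -/
def IsDecidable {L : FirstOrder.Language.{0, 0}} [EffectiveSignature L] (T : L.Theory) : Prop :=
  ∃ d : ℕ → Bool, Computable d ∧
    ∀ φ : L.Formula ℕ, φ.IsQF → (d (formulaCode φ) = true ↔ Satisfiable.{u} T φ)

/-- `T` is smooth: a quantifier-free formula satisfied by a `T`-interpretation with domain `A` is
satisfied by a `T`-interpretation of each cardinality `κ > |A|`. -/
def IsSmooth {L : FirstOrder.Language.{0, 0}} (T : L.Theory) : Prop :=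
  ∀ φ : L.Formula ℕ, φ.IsQF → ∀ (A : Type u) [L.Structure A] (v : ℕ → A),
    A ⊨ T → φ.Realize v → ∀ κ : Cardinal.{u}, #A < κ →
      ∃ (B : Type u) (_ : L.Structure B) (w : ℕ → B), B ⊨ T ∧ φ.Realize w ∧ #B = κ

/-- `T` has the finite model property (for quantifier-free formulas). -/
def HasFiniteModelProperty {L : FirstOrder.Language.{0, 0}} (T : L.Theory) : Prop :=
  ∀ φ : L.Formula ℕ, φ.IsQF → ∀ (A : Type u) [L.Structure A] (v : ℕ → A),
    A ⊨ T → φ.Realize v →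
      ∃ (B : Type u) (_ : L.Structure B) (w : ℕ → B), B ⊨ T ∧ φ.Realize w ∧ #B < ℵ₀

/-- The combination `T₁ ⊕ T₂`: the theory over the disjoint union of the two signatures that is
axiomatized by the axioms of `T₁` together with those of `T₂`. -/
def combination {L₁ L₂ : FirstOrder.Language.{0, 0}} (T₁ : L₁.Theory) (T₂ : L₂.Theory) :
    (L₁.sum L₂).Theory :=
  (LHom.sumInl : L₁ →ᴸ L₁.sum L₂).onTheory T₁ ∪ (LHom.sumInr : L₂ →ᴸ L₁.sum L₂).onTheory T₂

/-! ### Cardinality formulas -/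

section

variable {L : FirstOrder.Language.{0, 0}}

/-- `x₁, …, xₙ` are pairwise distinct. -/
noncomputable def distinct (n : ℕ) : L.BoundedFormula Empty n :=
  BoundedFormula.iInf fun ij : {ij : Fin n × Fin n // ij.1 < ij.2} =>
    ∼((&ij.1.1 : L.Term (Empty ⊕ Fin n)) =' &ij.1.2)

/-- With free variables `x₁, …, xₙ, y`: the formula `y = x₁ ∨ … ∨ y = xₙ`. -/
noncomputable def lastAmong (n : ℕ) : L.BoundedFormula Empty (n + 1) :=
  BoundedFormula.iSup fun i : Fin n =>
    (&(Fin.last n) : L.Term (Empty ⊕ Fin (n + 1))) =' &i.castSucc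

/-- `∃ x₁ … xₙ, x₁, …, xₙ` are pairwise distinct. -/
noncomputable def atLeast (n : ℕ) : L.Sentence := (distinct n).exs

/-- `∃ x₁ … xₙ, ∀ y, y = x₁ ∨ … ∨ y = xₙ`. -/
noncomputable def atMost (n : ℕ) : L.Sentence := (lastAmong n).all.exs

/-- The domain has exactly `n` elements. -/
noncomputable def exactly (n : ℕ) : L.Sentence := atLeast n ⊓ atMost n

end

/-! ### The theory `T₌` -/

/-- The predicate symbols `P₁, P₂, …`, all of arity `0`. -/
inductive PSymbol : ℕ → Type
  | P (n : ℕ+) : PSymbol 0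

/-- The signature with predicate symbols `P₁, P₂, …` of arity `0` and no function symbols. -/
def sigP : FirstOrder.Language.{0, 0} := ⟨fun _ => Empty, PSymbol⟩

/-- The symbol `Pₙ` is identified with the positive integer `n`. -/
def sigPRelationsEquiv : (Σ n, sigP.Relations n) ≃ ℕ+ where
  toFun | ⟨_, .P n⟩ => n
  invFun n := ⟨0, .P n⟩
  left_inv := by rintro ⟨_, ⟨n⟩⟩; rfl
  right_inv _ := rfl

def sigPFunctionsEquiv : (Σ n, sigP.Functions n) ≃ Empty where
  toFun F := F.2
  invFun := Empty.elim
  left_inv F := F.2.elim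
  right_inv x := x.elim

instance : EffectiveSignature sigP :=
  letI iF : Primcodable (Σ n, sigP.Functions n) := Primcodable.ofEquiv _ sigPFunctionsEquiv
  letI iR : Primcodable (Σ n, sigP.Relations n) := Primcodable.ofEquiv _ sigPRelationsEquiv
  { codeFunctions := iF
    codeRelations := iR
    computable_functionArity := (Computable.const 0).of_eq fun F => F.2.elim
    computable_relationArity := (Computable.const 0).of_eq fun R => by
      obtain ⟨_, ⟨n⟩⟩ := R; rfl }

/-- `Pₙ` as a predicate symbol of the signature. -/
def symP (n : ℕ+) : sigP.Relations 0 := PSymbol.P n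

/-- The sentence `Pₙ`. -/
def atomP (n : ℕ+) : sigP.Sentence :=
  (symP n).formula Fin.elim0

/-- `T₌`, axiomatized by `Pₙ → "there are exactly n elements"` for `n ≥ 1`. -/
noncomputable def TEq : sigP.Theory := {σ | ∃ n : ℕ+, σ = (atomP n).imp (exactly n)}

/-! ### The theories `T_f` -/

/-- The only function symbol `s`, of arity `1`. -/
inductive SSymbol : ℕ → Type
  | s : SSymbol 1

/-- The signature with one function symbol `s`, of arity `1`, and no predicate symbols. -/
def sigS : FirstOrder.Language.{0, 0} := ⟨SSymbol, fun _ => Empty⟩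

def sigSFunctionsEquiv : (Σ n, sigS.Functions n) ≃ Unit where
  toFun _ := ()
  invFun _ := ⟨1, .s⟩
  left_inv := by rintro ⟨_, ⟨⟩⟩; rfl
  right_inv _ := rfl

def sigSRelationsEquiv : (Σ n, sigS.Relations n) ≃ Empty where
  toFun R := R.2
  invFun := Empty.elim
  left_inv R := R.2.elim
  right_inv x := x.elim

instance : EffectiveSignature sigS :=
  letI iF : Primcodable (Σ n, sigS.Functions n) := Primcodable.ofEquiv _ sigSFunctionsEquiv
  letI iR : Primcodable (Σ n, sigS.Relations n) := Primcodable.ofEquiv _ sigSRelationsEquiv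
  { codeFunctions := iF
    codeRelations := iR
    computable_functionArity := (Computable.const 1).of_eq fun F => by
      obtain ⟨_, ⟨⟩⟩ := F; rfl
    computable_relationArity := (Computable.const 0).of_eq fun R => R.2.elim }

/-- `s` as a function symbol of the signature. -/
def symS : sigS.Functions 1 := SSymbol.s

/-- For `b = true` this is the formula `s(t) = t`, and for `b = false` the formula `¬ s(t) = t`. -/
def fixLiteral {n : ℕ} (b : Bool) (t : sigS.Term (Empty ⊕ Fin n)) : sigS.BoundedFormula Empty n :=
  bif b then symS.apply₁ t =' t
  else ∼(symS.apply₁ t =' t)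

/-- `∃ x₁ … xₙ`, pairwise distinct and all satisfying `s(x) = x` (if `b = true`), respectively
`¬ s(x) = x` (if `b = false`). -/
noncomputable def atLeastFix (b : Bool) (n : ℕ) : sigS.Sentence :=
  (distinct n ⊓ BoundedFormula.iInf fun i : Fin n => fixLiteral b &i).exs

/-- As `atLeastFix b n`, with the further conjunct that every `x` satisfying `s(x) = x`
(respectively `¬ s(x) = x`) is one of `x₁, …, xₙ`. -/
noncomputable def exactlyFix (b : Bool) (n : ℕ) : sigS.Sentence :=
  (distinct n ⊓ (BoundedFormula.iInf fun i : Fin n => fixLiteral b &i) ⊓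
    ((fixLiteral b &(Fin.last n)).imp (lastAmong n)).all).exs

/-- `count f b k` is the number of `i` with `1 ≤ i ≤ k` and `f i = b`. -/
def count (f : ℕ+ → Bool) (b : Bool) (k : ℕ+) : ℕ :=
  ((Finset.Icc 1 k).filter fun i => f i = b).card

/-- The axiom of `T_f` with index `k`. -/
noncomputable def sentenceTf (f : ℕ+ → Bool) (k : ℕ+) : sigS.Sentence :=
  (atLeastFix true (count f true k) ⊓ atLeastFix false (count f false k)) ⊔
    BoundedFormula.iSup fun i : Set.Icc (1 : ℕ+) k =>
      exactlyFix true (count f true i) ⊓ exactlyFix false (count f false i)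

/-- The theory `T_f`. -/
noncomputable def Tf (f : ℕ+ → Bool) : sigS.Theory := {σ | ∃ k : ℕ+, σ = sentenceTf f k}

/-- The standing assumption on `f` (where `true` stands for `1` and `false` for `0`): `f` is not
computable, `f 1 = 1`, and for each `k ≥ 1` half of the numbers `1, …, 2 ^ k` are mapped to `1` and
the other half to `0`. -/
structure IsAdmissible (f : ℕ+ → Bool) : Prop where
  not_computable : ¬ Computable f
  map_one : f 1 = true
  balanced : ∀ k : ℕ, 1 ≤ k → count f true (2 ^ k) = count f false (2 ^ k)

end TheoryCombination

/-! A model of `Tf f` has either infinitely many fixed and infinitely many non-fixed points of `s`,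
or, for some `i`, exactly `count f true i` and `count f false i` of them
(`IsAdmissible.model_Tf_iff`). These two counts add up to `i`, so the size of a finite model
determines its number of fixed points.

Quantifier-free formulas over `sigS` cannot exploit this, since they put no upper bound on the size.
By `exists_extension` a structure can be enlarged by any numbers of fixed and non-fixed points
without falsifying a satisfied formula, and balance makes both counts unbounded. So a formula is `Tf
f`-satisfiable as soon as it has any model at all. This gives the finite model property and a
decision procedure that never consults `f`; smoothness comes from the same extension and the
monotonicity of the counts.

In the combination the predicates supply the missing bound: `P_{n + 1}` together with `m` distinct
fixed points is satisfiable exactly if `m ≤ count f true (n + 1)`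
(`IsAdmissible.satisfiable_countFormula`). A decision procedure would therefore compute these
counts, and their increments are the values of `f`.

The positive decidability results are bounded searches. A formula with code `c` involves only terms
and symbols of code at most `c`, so small structures suffice; they are coded by digits of numbers,
and truth in them is primitive recursive (`formulaEval_eq_true_iff`, `primrec_formulaEval`). -/

namespace TheoryCombination

open FirstOrder FirstOrder.Language Cardinal

/-! ### Evaluation of Gödel numbers in finite structures -/

/-- The `i`-th digit of `t` in base `M`. -/
def digit (M t i : ℕ) : ℕ := t / M ^ i % M

theorem digit_lt {M : ℕ} (hM : 0 < M) (t i : ℕ) : digit M t i < M := Nat.mod_lt _ hM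

/-- Finite tables become numbers below `M ^ m`, which turns the search for a finite structure into a
bounded numerical search. -/
theorem exists_digit_eq {M m : ℕ} (g : ℕ → ℕ) (hg : ∀ i < m, g i < M) :
    ∃ t < M ^ m, ∀ i < m, digit M t i = g i := by
  let F : Fin m → Fin M := fun i => ⟨g i, hg i i.2⟩
  refine ⟨finFunctionFinEquiv F, (finFunctionFinEquiv F).2, fun i hi => ?_⟩
  exact congrArg Fin.val (congrFun (finFunctionFinEquiv.symm_apply_apply F) ⟨i, hi⟩)

theorem primrec_digit : Primrec fun x : ℕ × ℕ × ℕ => digit x.1 x.2.1 x.2.2 := by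
  have hpow : Primrec₂ (fun a b : ℕ => a ^ b) := Primrec₂.unpaired'.1 Nat.Primrec.pow
  exact Primrec.nat_mod.comp
    (Primrec.nat_div.comp (Primrec.fst.comp Primrec.snd)
      (hpow.comp Primrec.fst (Primrec.snd.comp Primrec.snd))) Primrec.fst

theorem lt_pair_right {a : ℕ} (ha : 0 < a) (b : ℕ) : b < Nat.pair a b := by
  unfold Nat.pair
  split_ifs with h
  · nlinarith
  · omega

theorem unpair_snd_lt {c : ℕ} (h : c.unpair.1 ≠ 0) : c.unpair.2 < c := by
  conv_rhs => rw [← Nat.pair_unpair c]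
  exact lt_pair_right (Nat.pos_of_ne_zero h) _

/-- The code of the first argument of the compound term coded by `c`. -/
def argCode (c : ℕ) : ℕ := (c.unpair.2.unpair.2 - 1).unpair.1

theorem argCode_lt {c : ℕ} (h : c.unpair.1 ≠ 0) : argCode c < c := by
  have h₁ := unpair_snd_lt h
  have h₂ := Nat.unpair_right_le c.unpair.2
  have h₃ := Nat.unpair_left_le (c.unpair.2.unpair.2 - 1)
  unfold argCode
  omega

/-- The value of the term coded by `c` in the structure with domain `{0, …, M - 1}` where every
function symbol is unary and interpreted by the digits of `t`, and where the digits of `v` are the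
values of the variables. -/
def termEval (M t v : ℕ) (c : ℕ) : ℕ :=
  -- The variable with index `i` sits in the left summand of `ℕ ⊕ Fin 0` and has code `2 * i` there,
  -- hence the halving.
  if h : c.unpair.1 = 0 then digit M v (c.unpair.2 / 2)
  else digit M t (termEval M t v (argCode c))
termination_by c
decreasing_by exact argCode_lt h

/-- The truth value of the quantifier-free formula coded by `c` in the structure of `termEval`,
where the predicate symbol with code `e` is true if `e + 1 = p` and false otherwise. -/
def formulaEval (M t v p : ℕ) (c : ℕ) : Bool :=
  if _ : c.unpair.1 = 3 then
    !(formulaEval M t v p c.unpair.2.unpair.1) || formulaEval M t v p c.unpair.2.unpair.2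
  else if c.unpair.1 = 1 then
    decide (termEval M t v c.unpair.2.unpair.1 = termEval M t v c.unpair.2.unpair.2)
  -- For `p = 0` no predicate symbol is true.
  else if c.unpair.1 = 2 then decide (c.unpair.2.unpair.1 + 1 = p)
  else false
termination_by c
decreasing_by
  · have := unpair_snd_lt (c := c) (by omega)
    have := Nat.unpair_left_le c.unpair.2
    omega
  · have := unpair_snd_lt (c := c) (by omega)
    have := Nat.unpair_right_le c.unpair.2
    omega

/-! ### Primitive recursiveness of the evaluation functions -/

section Primrec

open Primrec

theorem primrec_unpair_fst : Primrec fun c : ℕ => c.unpair.1 := fst.comp Primrec.unpair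

theorem primrec_unpair_snd : Primrec fun c : ℕ => c.unpair.2 := snd.comp Primrec.unpair

theorem primrec_argCode : Primrec argCode :=
  primrec_unpair_fst.comp
    (nat_sub.comp (primrec_unpair_snd.comp primrec_unpair_snd) (Primrec.const 1))

/-- Course-of-values recursion: `g` receives the list of the values at all smaller codes, and the
length of this list is the current code. The argument has a smaller code, so the default of `getD`
does not affect the result. -/
theorem primrec_termEval :
    Primrec₂ fun (a : ℕ × ℕ × ℕ) (c : ℕ) => termEval a.1 a.2.1 a.2.2 c := by
  let g : ℕ × ℕ × ℕ → List ℕ → Option ℕ := fun a l => some <|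
    if l.length.unpair.1 = 0 then digit a.1 a.2.2 (l.length.unpair.2 / 2)
    else digit a.1 a.2.1 (l.getD (argCode l.length) 0)
  have hlen : Primrec fun x : (ℕ × ℕ × ℕ) × List ℕ => x.2.length := list_length.comp snd
  have hg : Primrec₂ g := by
    refine option_some.comp (Primrec.ite ?_ ?_ ?_)
    · exact Primrec.eq.comp (primrec_unpair_fst.comp hlen) (Primrec.const 0)
    · exact primrec_digit.comp ((fst.comp fst).pair
        ((snd.comp (snd.comp fst)).pair
          (nat_div.comp (primrec_unpair_snd.comp hlen) (Primrec.const 2))))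
    · exact primrec_digit.comp ((fst.comp fst).pair ((fst.comp (snd.comp fst)).pair
        ((list_getD 0).comp snd (primrec_argCode.comp hlen))))
  refine nat_strong_rec _ hg fun a c => ?_
  simp only [g, List.length_map, List.length_range, Option.some.injEq]
  rw [termEval]
  split_ifs with h
  · rfl
  · rw [List.getD_eq_getElem _ _ (by simpa using argCode_lt h)]
    simp

theorem primrec_formulaEval : Primrec₂ fun (a : ℕ × ℕ × ℕ × ℕ) (c : ℕ) =>
    formulaEval a.1 a.2.1 a.2.2.1 a.2.2.2 c := by
  let g : ℕ × ℕ × ℕ × ℕ → List Bool → Option Bool := fun a l => some <|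
    if l.length.unpair.1 = 3 then
      !(l.getD l.length.unpair.2.unpair.1 false) || l.getD l.length.unpair.2.unpair.2 false
    else if l.length.unpair.1 = 1 then
      decide (termEval a.1 a.2.1 a.2.2.1 l.length.unpair.2.unpair.1 =
        termEval a.1 a.2.1 a.2.2.1 l.length.unpair.2.unpair.2)
    else if l.length.unpair.1 = 2 then decide (l.length.unpair.2.unpair.1 + 1 = a.2.2.2)
    else false
  have hlen : Primrec fun x : (ℕ × ℕ × ℕ × ℕ) × List Bool => x.2.length := list_length.comp snd
  have htag : ∀ i : ℕ, PrimrecPred fun x : (ℕ × ℕ × ℕ × ℕ) × List Bool =>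
      x.2.length.unpair.1 = i := fun i =>
    Primrec.eq.comp (primrec_unpair_fst.comp hlen) (Primrec.const i)
  have hl := primrec_unpair_fst.comp (primrec_unpair_snd.comp hlen)
  have hr := primrec_unpair_snd.comp (primrec_unpair_snd.comp hlen)
  have ha : Primrec fun x : (ℕ × ℕ × ℕ × ℕ) × List Bool =>
      ((x.1.1, x.1.2.1, x.1.2.2.1) : ℕ × ℕ × ℕ) :=
    (fst.comp fst).pair ((fst.comp (snd.comp fst)).pair (fst.comp (snd.comp (snd.comp fst))))
  have hg : Primrec₂ g := by
    have h₃ : Primrec fun x : (ℕ × ℕ × ℕ × ℕ) × List Bool =>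
        (!(x.2.getD x.2.length.unpair.2.unpair.1 false) ||
          x.2.getD x.2.length.unpair.2.unpair.2 false) :=
      Primrec.or.comp (Primrec.not.comp ((list_getD false).comp snd hl))
        ((list_getD false).comp snd hr)
    have hel := primrec_termEval.comp ha hl
    have her := primrec_termEval.comp ha hr
    have h₁ : Primrec fun x : (ℕ × ℕ × ℕ × ℕ) × List Bool =>
        decide (termEval x.1.1 x.1.2.1 x.1.2.2.1 x.2.length.unpair.2.unpair.1 =
          termEval x.1.1 x.1.2.1 x.1.2.2.1 x.2.length.unpair.2.unpair.2) :=
      PrimrecPred.decide (Primrec.eq.comp hel her)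
    have h₂ : Primrec fun x : (ℕ × ℕ × ℕ × ℕ) × List Bool =>
        decide (x.2.length.unpair.2.unpair.1 + 1 = x.1.2.2.2) :=
      PrimrecPred.decide
        (Primrec.eq.comp (Primrec.succ.comp hl) (snd.comp (snd.comp (snd.comp fst))))
    exact option_some.comp (Primrec.ite (htag 3) h₃ (Primrec.ite (htag 1) h₁
      (Primrec.ite (htag 2) h₂ (Primrec.const false))))
  refine nat_strong_rec _ hg fun a c => ?_
  simp only [g, List.length_map, List.length_range, Option.some.injEq]
  rw [formulaEval]
  split_ifs with h
  · have h₁ := unpair_snd_lt (c := c) (by omega)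
    have h₂ := Nat.unpair_left_le c.unpair.2
    have h₃ := Nat.unpair_right_le c.unpair.2
    rw [List.getD_eq_getElem _ _ (by simp; omega), List.getD_eq_getElem _ _ (by simp; omega)]
    simp
  all_goals rfl

end Primrec

/-! ### Evaluation of codes agrees with satisfaction -/

section Codes

variable {L : FirstOrder.Language.{0, 0}} [EffectiveSignature L]

theorem termEval_var {α : Type} [Encodable α] (M t v : ℕ) (x : α) :
    termEval M t v (termCode (.var x : L.Term α)) = digit M v (Encodable.encode x / 2) := by
  rw [termEval]
  simp [termCode]

/-- A nonempty list is coded by the successor of a pair, which is why `argCode` subtracts one before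
unpairing. -/
theorem argCode_func {α : Type} [Encodable α] {n : ℕ} (F : L.Functions (n + 1))
    (ts : Fin (n + 1) → L.Term α) : argCode (termCode (.func F ts)) = termCode (ts 0) := by
  simp [argCode, termCode, List.ofFn_succ]

theorem termEval_func {α : Type} [Encodable α] (M t v : ℕ) {n : ℕ} (F : L.Functions (n + 1))
    (ts : Fin (n + 1) → L.Term α) :
    termEval M t v (termCode (.func F ts)) = digit M t (termEval M t v (termCode (ts 0))) := by
  rw [termEval, argCode_func]
  simp [termCode]

theorem termCode_arg_lt {α : Type} [Encodable α] {n : ℕ} (F : L.Functions (n + 1))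
    (ts : Fin (n + 1) → L.Term α) : termCode (ts 0) < termCode (.func F ts) := by
  rw [← argCode_func F ts]
  exact argCode_lt (by simp [termCode])

/-- `formulaEval` gives the truth value of a quantifier-free formula if it does so for the atomic
formulas with smaller or equal code. -/
theorem formulaEval_eq_true_iff {A : Type u} [L.Structure A] (x : ℕ → A) (M t v p c : ℕ)
    (heq : ∀ t₁ t₂ : L.Term (ℕ ⊕ Fin 0), termCode t₁ ≤ c → termCode t₂ ≤ c →
      (termEval M t v (termCode t₁) = termEval M t v (termCode t₂) ↔
        t₁.realize (Sum.elim x default) = t₂.realize (Sum.elim x default)))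
    (hrel : ∀ {n : ℕ} (R : L.Relations n) (ts : Fin n → L.Term (ℕ ⊕ Fin 0)),
      Encodable.encode (⟨n, R⟩ : Σ n, L.Relations n) ≤ c →
      (Encodable.encode (⟨n, R⟩ : Σ n, L.Relations n) + 1 = p ↔
        Structure.RelMap R fun i => (ts i).realize (Sum.elim x default)))
    {φ : L.Formula ℕ} (hφ : φ.IsQF) (hc : formulaCode φ ≤ c) :
    formulaEval M t v p (formulaCode φ) = true ↔ φ.Realize x := by
  unfold Formula.Realize
  induction hφ with
  | falsum => rw [formulaEval]; simp [formulaCode, BoundedFormula.Realize]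
  | of_isAtomic h =>
    cases h with
    | equal t₁ t₂ =>
      have h₁ := Nat.right_le_pair 1 (Nat.pair (termCode t₁) (termCode t₂))
      have h₂ := Nat.left_le_pair (termCode t₁) (termCode t₂)
      have h₃ := Nat.right_le_pair (termCode t₁) (termCode t₂)
      change Nat.pair 1 (Nat.pair (termCode t₁) (termCode t₂)) ≤ c at hc
      rw [BoundedFormula.realize_bdEqual, ← heq t₁ t₂ (by omega) (by omega), formulaEval]
      simp [formulaCode, Term.bdEqual]
    | rel R ts =>
      have h₁ := Nat.right_le_pair 2 (Nat.pair (Encodable.encode (⟨_, R⟩ : Σ n, L.Relations n))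
        (Encodable.encode (List.ofFn fun i => termCode (ts i))))
      have h₂ := Nat.left_le_pair (Encodable.encode (⟨_, R⟩ : Σ n, L.Relations n))
        (Encodable.encode (List.ofFn fun i => termCode (ts i)))
      change Nat.pair 2 (Nat.pair (Encodable.encode (⟨_, R⟩ : Σ n, L.Relations n))
        (Encodable.encode (List.ofFn fun i => termCode (ts i)))) ≤ c at hc
      rw [BoundedFormula.realize_rel, ← hrel R ts (by omega), formulaEval]
      simp [formulaCode, Relations.boundedFormula]
  | @imp φ ψ _ _ ih₁ ih₂ =>
    have h₁ := Nat.right_le_pair 3 (Nat.pair (formulaCode φ) (formulaCode ψ))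
    have h₂ := Nat.left_le_pair (formulaCode φ) (formulaCode ψ)
    have h₃ := Nat.right_le_pair (formulaCode φ) (formulaCode ψ)
    change Nat.pair 3 (Nat.pair (formulaCode φ) (formulaCode ψ)) ≤ c at hc
    rw [BoundedFormula.realize_imp, ← ih₁ (by omega), ← ih₂ (by omega), formulaEval]
    simp only [formulaCode, Nat.unpair_pair]
    cases formulaEval M t v p (formulaCode φ) <;> simp

end Codes

/-! ### Finite representations of the values of terms -/

section Representative

variable {L : FirstOrder.Language.{0, 0}} [EffectiveSignature L] {A : Type u} [L.Structure A]

/-- The codes up to `c` of the terms with value `y`. -/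
def codesOfValue (x : ℕ → A) (c : ℕ) (y : A) : Set ℕ :=
  {k | k ≤ c ∧ ∃ τ : L.Term (ℕ ⊕ Fin 0), termCode τ = k ∧ τ.realize (Sum.elim x default) = y}

variable (L) in
/-- The least code of a term with value `y`, if there is a code up to `c`, and `0` otherwise. -/
noncomputable def representative (x : ℕ → A) (c : ℕ) (y : A) : ℕ :=
  sInf (codesOfValue (L := L) x c y)

theorem representative_lt (x : ℕ → A) (c : ℕ) (y : A) : representative L x c y < c + 1 := by
  unfold representative
  rcases (codesOfValue (L := L) x c y).eq_empty_or_nonempty with h | h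
  · simp [h]
  · exact Nat.lt_succ_of_le (Nat.sInf_mem h).1

/-- A code determines its term and the term determines its value, so the least code remembers the
value. Nonemptiness excludes the junk value `0`. -/
theorem representative_inj {x : ℕ → A} {c : ℕ} {y z : A}
    (hy : (codesOfValue (L := L) x c y).Nonempty) (hz : (codesOfValue (L := L) x c z).Nonempty) :
    representative L x c y = representative L x c z ↔ y = z := by
  refine ⟨fun h => ?_, fun h => h ▸ rfl⟩
  obtain ⟨-, σ, hσ, hσy⟩ := Nat.sInf_mem hy
  obtain ⟨-, τ, hτ, hτz⟩ := Nat.sInf_mem hz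
  obtain rfl : σ = τ := termCode_injective ((hσ.trans h).trans hτ.symm)
  exact hσy.symm.trans hτz

theorem codesOfValue_nonempty {c : ℕ} (x : ℕ → A) {τ : L.Term (ℕ ⊕ Fin 0)} (h : termCode τ ≤ c) :
    (codesOfValue (L := L) x c (τ.realize (Sum.elim x default))).Nonempty :=
  ⟨_, h, τ, rfl, rfl⟩

theorem encode_inl_div_two (i : ℕ) : Encodable.encode (Sum.inl i : ℕ ⊕ Fin 0) / 2 = i := by
  simp

theorem le_termCode_var (i : ℕ) : i ≤ termCode (.var (Sum.inl i) : L.Term (ℕ ⊕ Fin 0)) := by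
  have h₁ := Nat.right_le_pair 0 (Encodable.encode (Sum.inl i : ℕ ⊕ Fin 0))
  have h₂ := encode_inl_div_two i
  change i ≤ Nat.pair 0 (Encodable.encode (Sum.inl i : ℕ ⊕ Fin 0))
  omega

end Representative

/-- Bounded search whose bound depends on the parameter, reduced to search through the list
`List.range (b a)`. -/
theorem PrimrecPred.exists_lt_of {α : Type} [Primcodable α] {p : α → ℕ → Prop}
    (hp : PrimrecPred fun x : α × ℕ => p x.1 x.2) {b : α → ℕ} (hb : Primrec b) :
    PrimrecPred fun a => ∃ n < b a, p a n := by
  have h : PrimrecRel fun (n : ℕ) (a : α) => p a n := hp.comp (Primrec.snd.pair Primrec.fst)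
  have h' : PrimrecRel fun (l : List ℕ) (a : α) => ∃ n ∈ l, p a n := h.exists_mem_list
  exact (PrimrecPred.comp (f := fun a => (List.range (b a), a)) h'
    ((Primrec.list_range.comp hb).pair Primrec.id)).of_eq fun a => by simp

theorem primrec_pow : Primrec₂ fun a b : ℕ => a ^ b := Primrec₂.unpaired'.1 Nat.Primrec.pow

theorem primrecPred_formulaEval {α : Type} [Primcodable α] {M t v p c : α → ℕ} (hM : Primrec M)
    (ht : Primrec t) (hv : Primrec v) (hp : Primrec p) (hc : Primrec c) :
    PrimrecPred fun a => formulaEval (M a) (t a) (v a) (p a) (c a) = true := by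
  have h : Primrec fun a => formulaEval (M a) (t a) (v a) (p a) (c a) :=
    primrec_formulaEval.comp (hM.pair (ht.pair (hv.pair hp))) hc
  exact Primrec.eq.comp h (Primrec.const true)

/-! ### Quantifier-free satisfiability over `sigS` -/

/-- The term `s(τ)`. -/
def termS {α : Type} (τ : sigS.Term α) : sigS.Term α := symS.apply₁ τ

theorem sigS_term_cases {α : Type} (τ : sigS.Term α) :
    (∃ i, τ = .var i) ∨ ∃ ρ, τ = termS ρ := by
  rcases τ with i | ⟨⟨⟩, ts⟩
  · exact .inl ⟨i, rfl⟩
  · refine .inr ⟨ts 0, ?_⟩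
    unfold termS Functions.apply₁ symS
    congr 1
    funext i
    rw [Subsingleton.elim i 0]
    rfl

@[elab_as_elim]
theorem sigS_term_induction {α : Type} {motive : sigS.Term α → Prop}
    (var : ∀ i, motive (.var i)) (app : ∀ τ, motive τ → motive (termS τ)) (τ : sigS.Term α) :
    motive τ := by
  induction τ with
  | var i => exact var i
  | func F ts ih =>
    rcases sigS_term_cases (.func F ts) with ⟨i, h⟩ | ⟨ρ, h⟩
    · cases h
    · rw [h]
      refine app ρ ?_
      unfold termS Functions.apply₁ at h
      cases h
      exact ih 0

/-- The interpretation of `s`. -/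
def applyS {A : Type u} [sigS.Structure A] (y : A) : A := Structure.funMap symS ![y]

theorem realize_termS {A : Type u} [sigS.Structure A] {α : Type} (x : α → A) (τ : sigS.Term α) :
    (termS τ).realize x = applyS (τ.realize x) := by
  simp [termS, applyS, Functions.apply₁, Matrix.cons_fin_one]

theorem termEval_termS {α : Type} [Encodable α] (M t v : ℕ) (τ : sigS.Term α) :
    termEval M t v (termCode (termS τ)) = digit M t (termEval M t v (termCode τ)) :=
  termEval_func (L := sigS) M t v symS ![τ]

theorem termCode_lt_termS {α : Type} [Encodable α] (τ : sigS.Term α) :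
    termCode τ < termCode (termS τ) :=
  termCode_arg_lt (L := sigS) symS ![τ]

/-- The structure collapses to `{0, …, c}` by replacing each value with its representative. All
terms in `φ` have code at most `c`, so equalities between them are preserved. -/
theorem exists_formulaEval_of_realize {A : Type u} [sigS.Structure A] (x : ℕ → A)
    {φ : sigS.Formula ℕ} (hφ : φ.IsQF) (h : φ.Realize x) {c : ℕ} (hc : formulaCode φ = c) :
    ∃ t < (c + 1) ^ (c + 1), ∃ v < (c + 1) ^ (c + 1), formulaEval (c + 1) t v 0 c = true := by
  classical
  let r : A → ℕ := representative sigS x c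
  let R : A → Prop := fun y => (codesOfValue (L := sigS) x c y).Nonempty
  obtain ⟨v, hv, hvx⟩ := exists_digit_eq (M := c + 1) (m := c + 1) (fun i => r (x i))
    fun i _ => representative_lt x c _
  obtain ⟨t, ht, hts⟩ := exists_digit_eq (M := c + 1) (m := c + 1)
    -- A representative determines its value, so `s` is well defined on representatives. Other
    -- digits never arise in evaluating `φ`, and `0` is an arbitrary choice for them.
    (fun i => if hi : ∃ y, R y ∧ r y = i then r (applyS hi.choose) else 0)
    fun i _ => by split_ifs; exacts [representative_lt x c _, by omega]
  refine ⟨t, ht, v, hv, ?_⟩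
  have key : ∀ τ : sigS.Term (ℕ ⊕ Fin 0), termCode τ ≤ c →
      termEval (c + 1) t v (termCode τ) = r (τ.realize (Sum.elim x default)) := by
    intro τ
    induction τ using sigS_term_induction with
    | var i =>
      intro hi
      rcases i with i | i
      · rw [termEval_var, encode_inl_div_two, hvx i ((le_termCode_var i).trans_lt (by omega))]
        rfl
      · exact i.elim0
    | app τ ih =>
      intro hτ
      have hτ' := (termCode_lt_termS τ).le.trans hτ
      have hex : ∃ y, R y ∧ r y = r (τ.realize (Sum.elim x default)) :=
        ⟨_, codesOfValue_nonempty x hτ', rfl⟩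
      rw [termEval_termS, ih hτ', hts _ (representative_lt x c _), realize_termS, dif_pos hex,
        (representative_inj hex.choose_spec.1 (codesOfValue_nonempty x hτ')).1 hex.choose_spec.2]
  subst hc
  refine (formulaEval_eq_true_iff x _ _ _ _ _ (fun t₁ t₂ h₁ h₂ => ?_) (fun R => Empty.elim R) hφ
    le_rfl).2 h
  rw [key t₁ h₁, key t₂ h₂]
  exact representative_inj (codesOfValue_nonempty x h₁) (codesOfValue_nonempty x h₂)

/-- The structure in which `s` is interpreted by `g`. -/
@[reducible]
def structureOfMap {A : Type u} (g : A → A) : sigS.Structure A where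
  funMap := fun {n} F => match n, F with
    | _, .s => fun ts => g (ts 0)
  RelMap := fun R => R.elim

theorem applyS_structureOfMap {A : Type u} (g : A → A) (y : A) :
    @applyS A (structureOfMap g) y = g y := rfl

theorem exists_finite_realize_of_formulaEval {M t v : ℕ} (hM : 0 < M) {φ : sigS.Formula ℕ}
    (hφ : φ.IsQF) (h : formulaEval M t v 0 (formulaCode φ) = true) :
    ∃ (A : Type u) (_ : sigS.Structure A) (x : ℕ → A), Finite A ∧ φ.Realize x := by
  let _ : sigS.Structure (ULift.{u} (Fin M)) :=
    structureOfMap fun i => ⟨⟨digit M t i.down, digit_lt hM _ _⟩⟩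
  let x : ℕ → ULift.{u} (Fin M) := fun i => ⟨⟨digit M v i, digit_lt hM _ _⟩⟩
  refine ⟨ULift.{u} (Fin M), inferInstance, x, inferInstance, ?_⟩
  have key : ∀ τ : sigS.Term (ℕ ⊕ Fin 0), termEval M t v (termCode τ) =
      ((τ.realize (Sum.elim x default)).down : ℕ) := by
    intro τ
    induction τ using sigS_term_induction with
    | var i =>
      rcases i with i | i
      · rw [termEval_var, encode_inl_div_two]
        rfl
      · exact i.elim0
    | app τ ih =>
      rw [termEval_termS, ih, realize_termS, applyS_structureOfMap]
  refine (formulaEval_eq_true_iff x M t v 0 _ (fun t₁ t₂ _ _ => ?_) (fun R => Empty.elim R) hφ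
    le_rfl).1 h
  rw [key, key, Fin.val_inj, ULift.down_inj]

/-- Coding a structure by numbers and decoding these again yields a finite one. -/
theorem exists_finite_realize {A : Type u} [sigS.Structure A] (x : ℕ → A) {φ : sigS.Formula ℕ}
    (hφ : φ.IsQF) (h : φ.Realize x) :
    ∃ (B : Type u) (_ : sigS.Structure B) (y : ℕ → B), Finite B ∧ φ.Realize y := by
  obtain ⟨t, -, v, -, hc⟩ := exists_formulaEval_of_realize x hφ h rfl
  exact exists_finite_realize_of_formulaEval (Nat.succ_pos _) hφ hc

/-- A theory over `sigS` in which every quantifier-free formula that has a finite model is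
satisfiable is decidable. -/
theorem isDecidable_of_finite_models {T : sigS.Theory}
    (hT : ∀ φ : sigS.Formula ℕ, φ.IsQF → ∀ (A : Type u) [sigS.Structure A] (x : ℕ → A), Finite A →
      φ.Realize x → Satisfiable.{u} T φ) : IsDecidable.{u} T := by
  have hp : PrimrecPred fun c : ℕ => ∃ t < (c + 1) ^ (c + 1), ∃ v < (c + 1) ^ (c + 1),
      formulaEval (c + 1) t v 0 c = true := by
    refine PrimrecPred.exists_lt_of (p := fun c t => ∃ v < (c + 1) ^ (c + 1),
      formulaEval (c + 1) t v 0 c = true) ?_ (primrec_pow.comp Primrec.succ Primrec.succ)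
    refine PrimrecPred.exists_lt_of (α := ℕ × ℕ) (p := fun a v =>
      formulaEval (a.1 + 1) a.2 v 0 a.1 = true) ?_
      (primrec_pow.comp (Primrec.succ.comp Primrec.fst) (Primrec.succ.comp Primrec.fst))
    exact primrecPred_formulaEval (Primrec.succ.comp (Primrec.fst.comp Primrec.fst))
      (Primrec.snd.comp Primrec.fst) Primrec.snd (Primrec.const 0) (Primrec.fst.comp Primrec.fst)
  obtain ⟨_, hd⟩ := hp
  refine ⟨_, hd.to_comp, fun φ hφ => ?_⟩
  rw [decide_eq_true_iff]
  constructor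
  · rintro ⟨t, -, v, -, h⟩
    obtain ⟨A, _, x, hA, hx⟩ := exists_finite_realize_of_formulaEval.{u} (Nat.succ_pos _) hφ h
    exact hT φ hφ A x hA hx
  · rintro ⟨A, _, x, -, hx⟩
    exact exists_formulaEval_of_realize x hφ hx rfl

/-! ### Semantics of the cardinality formulas -/

section Cardinality

variable {L : FirstOrder.Language.{0, 0}} {A : Type u} [L.Structure A]

theorem realize_distinct {n : ℕ} (e : Empty → A) (xs : Fin n → A) :
    (distinct (L := L) n).Realize e xs ↔ Function.Injective xs := by
  simp only [distinct, BoundedFormula.realize_iInf, BoundedFormula.realize_not,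
    BoundedFormula.realize_bdEqual]
  constructor
  · intro h i j hij
    by_contra hne
    rcases lt_or_gt_of_ne hne with hlt | hlt
    · exact h ⟨(i, j), hlt⟩ hij
    · exact h ⟨(j, i), hlt⟩ hij.symm
  · rintro h ⟨⟨i, j⟩, hij⟩ heq
    exact hij.ne (h heq)

theorem realize_lastAmong {n : ℕ} (e : Empty → A) (xs : Fin n → A) (y : A) :
    (lastAmong (L := L) n).Realize e (Fin.snoc xs y) ↔ y ∈ Set.range xs := by
  simp [lastAmong, BoundedFormula.realize_iSup, eq_comm]

theorem realize_exactly {n : ℕ} :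
    A ⊨ (exactly n : L.Sentence) ↔ Nonempty (A ≃ Fin n) := by
  have h : A ⊨ (exactly n : L.Sentence) ↔ (∃ xs : Fin n → A, Function.Injective xs) ∧
      ∃ ys : Fin n → A, Function.Surjective ys := by
    simp only [exactly, atLeast, atMost, Sentence.Realize, Formula.realize_inf,
      BoundedFormula.realize_exs, BoundedFormula.realize_all, realize_distinct, realize_lastAmong]
    rfl
  rw [h]
  constructor
  · rintro ⟨⟨xs, hxs⟩, ys, hys⟩
    have : Finite A := Finite.of_surjective ys hys
    have h₁ := Nat.card_le_card_of_injective xs hxs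
    have h₂ := Nat.card_le_card_of_surjective ys hys
    rw [Nat.card_fin] at h₁ h₂
    exact ⟨Finite.equivFinOfCardEq (h₂.antisymm h₁)⟩
  · rintro ⟨e⟩
    exact ⟨⟨e.symm, e.symm.injective⟩, e.symm, e.symm.surjective⟩

end Cardinality

/-! ### Decidability of `T₌` -/

/-- The truth value of `Pₙ`. -/
def holdsP (A : Type u) [sigP.Structure A] (n : ℕ+) : Prop :=
  Structure.RelMap (M := A) (symP n) Fin.elim0

theorem model_TEq_iff {A : Type u} [sigP.Structure A] :
    A ⊨ TEq ↔ ∀ n, holdsP A n → Nonempty (A ≃ Fin n) := by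
  have h (n : ℕ+) : A ⊨ ((atomP n).imp (exactly n) : sigP.Sentence) ↔
      (holdsP A n → Nonempty (A ≃ Fin n)) := by
    rw [← realize_exactly (L := sigP)]
    simp only [Sentence.Realize, Formula.realize_imp]
    refine imp_congr_left ?_
    rw [atomP, Formula.realize_rel, holdsP]
    exact iff_of_eq (congrArg _ (Subsingleton.elim _ _))
  simp only [Theory.model_iff, TEq, Set.mem_ofPred_eq, forall_exists_index]
  exact ⟨fun H n => (h n).1 (H _ n rfl), by rintro H _ n rfl; exact (h n).2 (H n)⟩

/-- The structure in which `Pₙ` has truth value `p n`. -/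
@[reducible]
def structureOfPred (A : Type u) (p : ℕ+ → Prop) : sigP.Structure A where
  funMap := fun F => F.elim
  RelMap := fun {n} R => match n, R with
    | _, .P n => fun _ => p n

theorem encode_symP (n : ℕ+) :
    Encodable.encode (⟨0, symP n⟩ : Σ n, sigP.Relations n) + 1 = n :=
  n.natPred_add_one

theorem sigP_term_cases {α : Type} (τ : sigP.Term α) : ∃ i, τ = .var i := by
  rcases τ with i | ⟨F, -⟩
  · exact ⟨i, rfl⟩
  · exact Empty.elim F

theorem relMap_iff_holdsP {A : Type u} [sigP.Structure A] {n : ℕ+} (x : Fin 0 → A) :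
    Structure.RelMap (symP n) x ↔ holdsP A n :=
  iff_of_eq (congrArg _ (Subsingleton.elim _ _))

/-- `formulaEval` for formulas over `sigP`. -/
theorem formulaEval_sigP_iff {A : Type u} [sigP.Structure A] (x : ℕ → A) {M v p c : ℕ}
    (r : A → ℕ) (hr : ∀ i j, r (x i) = r (x j) → i ≤ c → j ≤ c → x i = x j)
    (hv : ∀ i ≤ c, digit M v i = r (x i))
    (hp : ∀ n : ℕ+, (n : ℕ) ≤ c + 1 → ((n : ℕ) = p ↔ holdsP A n))
    {φ : sigP.Formula ℕ} (hφ : φ.IsQF) (hc : formulaCode φ = c) :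
    formulaEval M 0 v p c = true ↔ φ.Realize x := by
  subst hc
  refine formulaEval_eq_true_iff x _ _ _ _ _ (fun t₁ t₂ h₁ h₂ => ?_) (fun R ts h => ?_) hφ le_rfl
  · obtain ⟨i | i, rfl⟩ := sigP_term_cases t₁
    · obtain ⟨j | j, rfl⟩ := sigP_term_cases t₂
      · have hi := (le_termCode_var i).trans h₁
        have hj := (le_termCode_var j).trans h₂
        rw [termEval_var, termEval_var, encode_inl_div_two, encode_inl_div_two, hv i hi, hv j hj]
        exact ⟨fun h => hr i j h hi hj, fun h => congrArg r h⟩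
      · exact j.elim0
    · exact i.elim0
  · rcases R with ⟨n⟩
    have h' : Encodable.encode (⟨0, symP n⟩ : Σ n, sigP.Relations n) ≤ _ := h
    have hn := encode_symP n
    refine Iff.trans ?_ ((hp n (by omega)).trans (relMap_iff_holdsP _).symm)
    rw [← hn]
    rfl

/-- The cases are whether some predicate that can occur in `φ` holds. If `P_n` does, the domain has
exactly `n` elements and no other predicate can hold. If none does, the size is irrelevant and only
the values of the variables matter. -/
theorem exists_formulaEval_of_satisfiable {φ : sigP.Formula ℕ} (hφ : φ.IsQF) {c : ℕ}
    (hc : formulaCode φ = c) (h : Satisfiable.{u} TEq φ) :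
    (∃ v < (c + 1) ^ (c + 1), formulaEval (c + 1) 0 v 0 c = true) ∨
      ∃ n < c + 1, ∃ v < (n + 1) ^ (c + 1), formulaEval (n + 1) 0 v (n + 1) c = true := by
  obtain ⟨A, _, x, hA, hx⟩ := h
  rw [model_TEq_iff] at hA
  -- `P_n` has code `n - 1`, so in a formula with code `c` only indices up to `c + 1` occur.
  by_cases hP : ∃ n : ℕ+, (n : ℕ) ≤ c + 1 ∧ holdsP A n
  · obtain ⟨n, hn, hPn⟩ := hP
    obtain ⟨e⟩ := hA n hPn
    obtain ⟨k, hk⟩ : ∃ k, (n : ℕ) = k + 1 := ⟨n.natPred, n.natPred_add_one.symm⟩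
    obtain ⟨v, hv, hvx⟩ := exists_digit_eq (M := k + 1) (m := c + 1) (fun i => (e (x i) : ℕ))
      fun i _ => (e (x i)).2.trans_eq hk
    refine .inr ⟨k, by omega, v, hv, ?_⟩
    refine (formulaEval_sigP_iff x (fun y => (e y : ℕ)) (fun i j h _ _ => ?_)
      (fun i hi => hvx i (by omega)) (fun m _ => ⟨fun h => ?_, fun h => ?_⟩) hφ hc).2 hx
    · exact e.injective (Fin.ext h)
    · rwa [PNat.eq (h.trans hk.symm)]
    · obtain ⟨e'⟩ := hA m h
      rw [← hk]
      exact Fin.equiv_iff_eq.1 ⟨e'.symm.trans e⟩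
  -- A value of a variable is represented by the least index of a variable with that value.
  · have hmem (i : ℕ) : x (sInf {j | x j = x i}) = x i :=
      Nat.sInf_mem (s := {j | x j = x i}) ⟨i, rfl⟩
    have hle (i : ℕ) : sInf {j | x j = x i} ≤ i := Nat.sInf_le rfl
    obtain ⟨v, hv, hvx⟩ := exists_digit_eq (M := c + 1) (m := c + 1)
      (fun i => sInf {j | x j = x i}) fun i hi => (hle i).trans_lt hi
    refine .inl ⟨v, hv, ?_⟩
    refine (formulaEval_sigP_iff x (fun y => sInf {j | x j = y}) (fun i j h _ _ => ?_)
      (fun i hi => hvx i (by omega)) (fun m hm => ⟨fun h => ?_, fun h => ?_⟩) hφ hc).2 hx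
    · rw [← hmem i, ← hmem j]
      exact congrArg x h
    · exact absurd h m.ne_zero
    · exact absurd ⟨m, hm, h⟩ hP

/-- For `p = 0` the axioms hold vacuously; for `p = M` the only true predicate states the actual
size of the domain. -/
theorem satisfiable_of_formulaEval {φ : sigP.Formula ℕ} (hφ : φ.IsQF) {M v p : ℕ} (hM : 0 < M)
    (hp : p = 0 ∨ p = M) (h : formulaEval M 0 v p (formulaCode φ) = true) :
    Satisfiable.{u} TEq φ := by
  let _ : sigP.Structure (ULift.{u} (Fin M)) := structureOfPred _ fun n => (n : ℕ) = p
  refine ⟨ULift.{u} (Fin M), inferInstance, fun i => ⟨⟨digit M v i, digit_lt hM _ _⟩⟩, ?_, ?_⟩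
  · refine model_TEq_iff.2 fun n (hn : (n : ℕ) = p) => ?_
    have := n.pos
    obtain rfl : (n : ℕ) = M := by omega
    exact ⟨Equiv.ulift⟩
  · exact (formulaEval_sigP_iff _ (fun y => (y.down : ℕ))
      (fun i j h _ _ => ULift.down_injective (Fin.ext h)) (fun i _ => rfl) (fun n _ => Iff.rfl)
      hφ rfl).1 h

theorem isDecidable_TEq : IsDecidable.{u} TEq := by
  have h₁ : PrimrecPred fun c : ℕ => ∃ v < (c + 1) ^ (c + 1),
      formulaEval (c + 1) 0 v 0 c = true := by
    refine PrimrecPred.exists_lt_of (p := fun c v => formulaEval (c + 1) 0 v 0 c = true) ?_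
      (primrec_pow.comp Primrec.succ Primrec.succ)
    exact primrecPred_formulaEval (Primrec.succ.comp Primrec.fst) (Primrec.const 0) Primrec.snd
      (Primrec.const 0) Primrec.fst
  have h₂ : PrimrecPred fun c : ℕ => ∃ n < c + 1, ∃ v < (n + 1) ^ (c + 1),
      formulaEval (n + 1) 0 v (n + 1) c = true := by
    refine PrimrecPred.exists_lt_of (p := fun c n => ∃ v < (n + 1) ^ (c + 1),
      formulaEval (n + 1) 0 v (n + 1) c = true) ?_ Primrec.succ
    refine PrimrecPred.exists_lt_of (α := ℕ × ℕ) (p := fun a v =>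
      formulaEval (a.2 + 1) 0 v (a.2 + 1) a.1 = true) ?_
      (primrec_pow.comp (Primrec.succ.comp Primrec.snd) (Primrec.succ.comp Primrec.fst))
    have hn : Primrec fun x : (ℕ × ℕ) × ℕ => x.1.2 + 1 :=
      Primrec.succ.comp (Primrec.snd.comp Primrec.fst)
    exact primrecPred_formulaEval hn (Primrec.const 0) Primrec.snd hn
      (Primrec.fst.comp Primrec.fst)
  obtain ⟨_, hd⟩ := h₁.or h₂
  refine ⟨_, hd.to_comp, fun φ hφ => ?_⟩
  rw [decide_eq_true_iff]
  refine ⟨?_, exists_formulaEval_of_satisfiable hφ rfl⟩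
  rintro (⟨v, -, h⟩ | ⟨n, -, v, -, h⟩)
  · exact satisfiable_of_formulaEval hφ (Nat.succ_pos _) (.inl rfl) h
  · exact satisfiable_of_formulaEval hφ (Nat.succ_pos _) (.inr rfl) h

/-! ### Models of `T_f` -/

theorem encard_range_of_injective {A : Type u} {Z : Type*} {j : Z → A}
    (hj : Function.Injective j) : (Set.range j).encard = ENat.card Z := by
  rw [← Set.image_univ, hj.encard_image, Set.encard_univ]

theorem exists_injective_mem_iff {A : Type u} {S : Set A} {n : ℕ} :
    (∃ xs : Fin n → A, Function.Injective xs ∧ ∀ i, xs i ∈ S) ↔ (n : ℕ∞) ≤ S.encard := by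
  constructor
  · rintro ⟨xs, hxs, hS⟩
    have h := Set.encard_le_encard (Set.range_subset_iff.2 hS)
    rwa [encard_range_of_injective hxs, ENat.card_eq_coe_fintype_card, Fintype.card_fin] at h
  · intro h
    obtain ⟨t, hts, ht⟩ := Set.exists_subset_encard_eq h
    have hfin : t.Finite := Set.finite_of_encard_eq_coe ht
    have hcard : Nat.card t = n := by
      rw [Nat.card_coe_set_eq, Set.ncard, ht, ENat.toNat_natCast]
    have := hfin.to_subtype
    let e := Finite.equivFinOfCardEq hcard
    exact ⟨fun i => e.symm i, Subtype.val_injective.comp e.symm.injective,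
      fun i => hts (e.symm i).2⟩

theorem exists_injective_range_eq_iff {A : Type u} {S : Set A} {n : ℕ} :
    (∃ xs : Fin n → A, (Function.Injective xs ∧ ∀ i, xs i ∈ S) ∧ ∀ y ∈ S, y ∈ Set.range xs) ↔
      S.encard = n := by
  constructor
  · rintro ⟨xs, ⟨hxs, hS⟩, hr⟩
    rw [← (Set.range_subset_iff.2 hS).antisymm hr, encard_range_of_injective hxs,
      ENat.card_eq_coe_fintype_card, Fintype.card_fin]
  · intro h
    obtain ⟨xs, hxs, hS⟩ := exists_injective_mem_iff.2 h.ge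
    refine ⟨xs, ⟨hxs, hS⟩, fun y hy => ?_⟩
    have hfin : S.Finite := Set.finite_of_encard_eq_coe h
    have hr : (Set.range xs).encard = n := by
      rw [encard_range_of_injective hxs, ENat.card_eq_coe_fintype_card, Fintype.card_fin]
    rwa [(hfin.subset (Set.range_subset_iff.2 hS)).eq_of_subset_of_encard_le
      (Set.range_subset_iff.2 hS) (h.trans hr.symm).le]

/-- The elements with `s(y) = y` (if `b = true`), respectively `s(y) ≠ y` (if `b = false`). -/
def fixSet (A : Type u) [sigS.Structure A] (b : Bool) : Set A := {y | applyS y = y ↔ b = true}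

section

variable {A : Type u} [sigS.Structure A]

theorem mem_fixSet_true {y : A} : y ∈ fixSet A true ↔ applyS y = y := by simp [fixSet]

theorem mem_fixSet_false {y : A} : y ∈ fixSet A false ↔ applyS y ≠ y := by simp [fixSet]

theorem encard_fixSet_add :
    (fixSet A true).encard + (fixSet A false).encard = ENat.card A := by
  have h : fixSet A false = (fixSet A true)ᶜ := by
    ext y; rw [Set.mem_compl_iff, mem_fixSet_true, mem_fixSet_false]
  rw [h, Set.encard_add_encard_compl, Set.encard_univ]

theorem realize_fixLiteral {n : ℕ} (b : Bool) (t : sigS.Term (Empty ⊕ Fin n)) (e : Empty → A)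
    (xs : Fin n → A) :
    (fixLiteral b t).Realize e xs ↔ t.realize (Sum.elim e xs) ∈ fixSet A b := by
  have h := realize_termS (Sum.elim e xs) t
  unfold termS at h
  cases b
  · rw [mem_fixSet_false]
    simp [fixLiteral, h]
  · rw [mem_fixSet_true]
    simp [fixLiteral, h]

theorem realize_atLeastFix (b : Bool) (n : ℕ) :
    A ⊨ atLeastFix b n ↔ (n : ℕ∞) ≤ (fixSet A b).encard := by
  rw [← exists_injective_mem_iff]
  simp only [atLeastFix, Sentence.Realize, BoundedFormula.realize_exs, BoundedFormula.realize_inf,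
    realize_distinct, BoundedFormula.realize_iInf, realize_fixLiteral]
  rfl

theorem realize_exactlyFix (b : Bool) (n : ℕ) :
    A ⊨ exactlyFix b n ↔ (fixSet A b).encard = n := by
  rw [← exists_injective_range_eq_iff]
  simp only [exactlyFix, Sentence.Realize, BoundedFormula.realize_exs, BoundedFormula.realize_inf,
    realize_distinct, BoundedFormula.realize_iInf, realize_fixLiteral, BoundedFormula.realize_all,
    BoundedFormula.realize_imp, realize_lastAmong]
  simp

theorem realize_sentenceTf (f : ℕ+ → Bool) (k : ℕ+) : A ⊨ sentenceTf f k ↔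
    (∀ b, (count f b k : ℕ∞) ≤ (fixSet A b).encard) ∨
      ∃ i ≤ k, ∀ b, (fixSet A b).encard = count f b i := by
  have h₁ : A ⊨ sentenceTf f k ↔
      (A ⊨ atLeastFix true (count f true k) ∧ A ⊨ atLeastFix false (count f false k)) ∨
        ∃ i : Set.Icc (1 : ℕ+) k,
          A ⊨ exactlyFix true (count f true i) ∧ A ⊨ exactlyFix false (count f false i) := by
    simp only [sentenceTf, Sentence.Realize, Formula.Realize, BoundedFormula.realize_sup,
      BoundedFormula.realize_inf, BoundedFormula.realize_iSup]
  rw [h₁]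
  simp only [realize_atLeastFix, realize_exactlyFix, Bool.forall_bool, and_comm, Subtype.exists,
    Set.mem_Icc, one_le, true_and, exists_prop]

end

theorem count_mono (f : ℕ+ → Bool) (b : Bool) {i k : ℕ+} (h : i ≤ k) :
    count f b i ≤ count f b k :=
  Finset.card_le_card (Finset.filter_subset_filter _ (Finset.Icc_subset_Icc_right h))

theorem count_add (f : ℕ+ → Bool) (k : ℕ+) : count f true k + count f false k = k := by
  have h := Finset.card_filter_add_card_filter_not (s := Finset.Icc 1 k) (fun i => f i = true)
  simpa [count] using h

theorem IsAdmissible.exists_le_count {f : ℕ+ → Bool} (hf : IsAdmissible f) (n : ℕ) :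
    ∃ k, ∀ b, n ≤ count f b k := by
  -- Balance makes both counts equal to `2 ^ n` here, and this exceeds `n`.
  refine ⟨2 ^ (n + 1), ?_⟩
  have h₁ := hf.balanced (n + 1) (by omega)
  have h₂ := count_add f (2 ^ (n + 1))
  have h₃ := Nat.lt_two_pow_self (n := n)
  have h₄ : 2 ^ (n + 1) = 2 * 2 ^ n := pow_succ' 2 n
  rw [PNat.pow_coe, PNat.val_ofNat] at h₂
  rw [Bool.forall_bool]
  omega

/-- If no exact alternative ever holds, every axiom must hold through its lower bounds, which are
unbounded for both values of `b`. Conversely, exact counts at `i` satisfy the exact alternative of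
axiom `k` if `i ≤ k`, and its lower bounds by monotonicity if `k ≤ i`. -/
theorem IsAdmissible.model_Tf_iff {f : ℕ+ → Bool} (hf : IsAdmissible f) {A : Type u}
    [sigS.Structure A] : A ⊨ Tf f ↔
      (∀ b, (fixSet A b).encard = ⊤) ∨ ∃ i, ∀ b, (fixSet A b).encard = count f b i := by
  simp only [Theory.model_iff, Tf, Set.mem_ofPred_eq, forall_exists_index]
  constructor
  · intro h
    have h' (k : ℕ+) := (realize_sentenceTf f k).1 (h _ k rfl)
    by_cases hex : ∃ i, ∀ b, (fixSet A b).encard = count f b i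
    · exact .inr hex
    · refine .inl fun b => ENat.eq_top_iff_forall_ge.2 fun n => ?_
      obtain ⟨k, hk⟩ := hf.exists_le_count n
      rcases h' k with hle | ⟨i, -, hi⟩
      · exact (Nat.cast_le.2 (hk b)).trans (hle b)
      · exact absurd ⟨i, hi⟩ hex
  · rintro h _ k rfl
    rw [realize_sentenceTf]
    rcases h with h | ⟨i, hi⟩
    · exact .inl fun b => (h b).symm ▸ le_top
    · rcases le_total i k with hik | hik
      · exact .inr ⟨i, hik, hi⟩
      · exact .inl fun b => (hi b).symm ▸ Nat.cast_le.2 (count_mono f b hik)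

/-! ### Smoothness and the finite model property of `T_f` -/

/-- A structure can be extended by prescribed numbers of fixed and of other elements. -/
theorem exists_extension {A : Type u} [sigS.Structure A] (x : ℕ → A) (X Y : Type u) :
    ∃ _ : sigS.Structure (A ⊕ (X ⊕ Y)),
      (∀ φ : sigS.Formula ℕ, φ.IsQF → φ.Realize x → φ.Realize (Sum.inl ∘ x : ℕ → A ⊕ (X ⊕ Y))) ∧
      (fixSet (A ⊕ (X ⊕ Y)) true).encard = (fixSet A true).encard + ENat.card X ∧
      (fixSet (A ⊕ (X ⊕ Y)) false).encard = (fixSet A false).encard + ENat.card Y := by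
  -- Elements of `X` are fixed, while those of `Y` are sent into `A` and so are not. `A` remains
  -- closed under `s`, hence a substructure.
  let g : A ⊕ (X ⊕ Y) → A ⊕ (X ⊕ Y) :=
    Sum.elim (fun a => .inl (applyS a)) (Sum.elim (fun z => .inr (.inl z)) fun _ => .inl (x 0))
  let S : sigS.Structure (A ⊕ (X ⊕ Y)) := structureOfMap g
  have happ (y) : applyS y = g y := rfl
  let emb : A ↪[sigS] A ⊕ (X ⊕ Y) :=
    { toFun := Sum.inl
      inj' := Sum.inl_injective
      map_fun' := by
        rintro _ ⟨⟩ ts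
        have hts : ts = ![ts 0] := by
          funext i
          rw [Subsingleton.elim i 0]
          rfl
        conv_lhs => rw [hts]
        rfl
      map_rel' := fun R => Empty.elim R }
  have hencard {Z : Type u} (j : Z → X ⊕ Y) (hj : Function.Injective j) (b : Bool)
      (hfix : fixSet (A ⊕ (X ⊕ Y)) b = Sum.inl '' fixSet A b ∪ Set.range (Sum.inr ∘ j)) :
      (fixSet (A ⊕ (X ⊕ Y)) b).encard = (fixSet A b).encard + ENat.card Z := by
    rw [hfix, Set.encard_union_eq, Sum.inl_injective.encard_image,
      encard_range_of_injective (Sum.inr_injective.comp hj)]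
    rw [Set.disjoint_left]
    rintro _ ⟨a, -, rfl⟩ ⟨z, hz⟩
    cases hz
  refine ⟨S, fun φ hφ h => ?_, hencard Sum.inl Sum.inl_injective true ?_,
    hencard Sum.inr Sum.inr_injective false ?_⟩
  · have := (BoundedFormula.IsQF.isExistential hφ).realize_embedding emb h
    rw [Formula.Realize]
    convert this
    rfl
  · ext (a | z | z)
    · simp [mem_fixSet_true, happ, g]
    · simp [mem_fixSet_true, happ, g]
    · simp [mem_fixSet_true, happ, g]
  · ext (a | z | z)
    · simp [mem_fixSet_false, happ, g]
    · simp [mem_fixSet_false, happ, g]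
    · simp [mem_fixSet_false, happ, g]

/-- A structure with finitely many elements can be extended to a model of `T_f` of size `k`, if `k`
is suitable. -/
theorem IsAdmissible.exists_extension_of_count {f : ℕ+ → Bool} (hf : IsAdmissible f) {A : Type u}
    [sigS.Structure A] (x : ℕ → A) {φ : sigS.Formula ℕ} (hφ : φ.IsQF) (h : φ.Realize x) (k : ℕ+)
    (hk : ∀ b, (fixSet A b).encard ≤ count f b k) :
    ∃ (B : Type u) (_ : sigS.Structure B) (y : ℕ → B), B ⊨ Tf f ∧ φ.Realize y ∧
      #B = ((k : ℕ) : Cardinal.{u}) := by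
  -- The truncated subtraction is the true deficit, because `hk` bounds the existing number by the
  -- target.
  have hadd (b : Bool) : (fixSet A b).encard +
      ENat.card (ULift.{u} (Fin (count f b k - (fixSet A b).ncard))) = count f b k := by
    have hfin : (fixSet A b).Finite :=
      Set.encard_lt_top_iff.1 ((hk b).trans_lt (ENat.natCast_lt_top _))
    have hle := hk b
    rw [← hfin.cast_ncard_eq] at hle ⊢
    rw [ENat.card_eq_coe_fintype_card, Fintype.card_ulift, Fintype.card_fin, ← Nat.cast_add,
      Nat.add_sub_cancel' (Nat.cast_le.1 hle)]
  obtain ⟨S, hS, ht, hff⟩ := exists_extension x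
    (ULift.{u} (Fin (count f true k - (fixSet A true).ncard)))
    (ULift.{u} (Fin (count f false k - (fixSet A false).ncard)))
  rw [hadd] at ht hff
  refine ⟨_, S, _, hf.model_Tf_iff.2 (.inr ⟨k, Bool.forall_bool.2 ⟨hff, ht⟩⟩), hS φ hφ h, ?_⟩
  rw [← toENat_eq_natCast, ← count_add f k, Nat.cast_add, ← ht, ← hff]
  exact encard_fixSet_add.symm

theorem IsAdmissible.exists_finite_model {f : ℕ+ → Bool} (hf : IsAdmissible f) {A : Type u}
    [sigS.Structure A] (x : ℕ → A) [Finite A] {φ : sigS.Formula ℕ} (hφ : φ.IsQF)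
    (h : φ.Realize x) :
    ∃ (B : Type u) (_ : sigS.Structure B) (y : ℕ → B), B ⊨ Tf f ∧ φ.Realize y ∧ #B < ℵ₀ := by
  obtain ⟨k, hk⟩ := hf.exists_le_count (Nat.card A)
  obtain ⟨B, S, y, hB, hy, hc⟩ := hf.exists_extension_of_count x hφ h k fun b => by
    refine (Set.encard_le_encard (Set.subset_univ _)).trans ?_
    rw [Set.encard_univ, ENat.card_eq_coe_natCard]
    exact Nat.cast_le.2 (hk b)
  exact ⟨B, S, y, hB, hy, hc ▸ natCast_lt_aleph0⟩

theorem IsAdmissible.hasFiniteModelProperty {f : ℕ+ → Bool} (hf : IsAdmissible f) :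
    HasFiniteModelProperty.{u} (Tf f) := by
  intro φ hφ A _ x _ h
  obtain ⟨B, _, y, _, hy⟩ := exists_finite_realize x hφ h
  exact hf.exists_finite_model y hφ hy

/-- `Tf f`-satisfiability coincides with satisfiability in some `sigS`-structure, a condition
independent of `f`; non-computability of `f` is therefore no obstacle. -/
theorem IsAdmissible.isDecidable_Tf {f : ℕ+ → Bool} (hf : IsAdmissible f) :
    IsDecidable.{u} (Tf f) := by
  refine isDecidable_of_finite_models fun φ hφ A _ x _ h => ?_
  obtain ⟨B, S, y, hB, hy, -⟩ := hf.exists_finite_model x hφ h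
  exact ⟨B, S, y, hB, hy⟩

theorem IsAdmissible.isSmooth {f : ℕ+ → Bool} (hf : IsAdmissible f) : IsSmooth.{u} (Tf f) := by
  intro φ hφ A _ x hA h κ hκ
  rcases lt_or_ge κ ℵ₀ with hfin | hinf
  · obtain ⟨k, rfl⟩ := lt_aleph0.1 hfin
    have hcard : ENat.card A < (k : ℕ∞) := toENat_lt_natCast.2 hκ
    rw [← encard_fixSet_add] at hcard
    -- A model smaller than a finite `k` has exact counts at its own size `i < k`, and these are at
    -- most the counts at `k`.
    rcases hf.model_Tf_iff.1 hA with htop | ⟨i, hi⟩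
    · simp [htop] at hcard
    · rw [hi, hi, ← Nat.cast_add, count_add, Nat.cast_lt] at hcard
      obtain ⟨k, rfl⟩ : ∃ k' : ℕ+, (k' : ℕ) = k := ⟨⟨k, by omega⟩, rfl⟩
      refine hf.exists_extension_of_count x hφ h k fun b => ?_
      rw [hi b]
      exact Nat.cast_le.2 (count_mono f b (PNat.coe_le_coe _ _ |>.1 hcard.le))
  -- Adding `κ` fixed and `κ` non-fixed points makes both sets infinite and leaves the total at `κ`.
  · have : Infinite κ.out := by rwa [infinite_iff, mk_out]
    obtain ⟨S, hS, ht, hff⟩ := exists_extension x κ.out κ.out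
    refine ⟨_, S, _, hf.model_Tf_iff.2 (.inl (Bool.forall_bool.2 ⟨?_, ?_⟩)), hS φ hφ h, ?_⟩
    · rw [hff, ENat.card_eq_top_of_infinite, add_top]
    · rw [ht, ENat.card_eq_top_of_infinite, add_top]
    · have hsum : #(A ⊕ (κ.out ⊕ κ.out)) = #A + (#κ.out + #κ.out) := by
        simp only [mk_sum, lift_id]
      rw [hsum, mk_out, add_eq_self hinf, add_eq_right hinf hκ.le]

/-! ### Existence of admissible functions -/

theorem primrec_natPred : Primrec PNat.natPred := (Primrec.encode (α := ℕ+)).of_eq fun _ => rfl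

theorem primrec_succPNat : Primrec Nat.succPNat := (Primrec.ofNat ℕ+).of_eq fun _ => rfl

theorem count_add_one (f : ℕ+ → Bool) (b : Bool) (k : ℕ+) :
    count f b (k + 1) = count f b k + if f (k + 1) = b then 1 else 0 := by
  have h : Finset.Icc 1 (k + 1) = insert (k + 1) (Finset.Icc 1 k) := by
    ext i
    simp only [Finset.mem_insert, Finset.mem_Icc, one_le, true_and, ← PNat.coe_le_coe,
      ← PNat.coe_inj, PNat.add_coe, PNat.one_coe]
    omega
  have hk : k + 1 ∉ Finset.Icc 1 k := by simp
  unfold count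
  rw [h, Finset.filter_insert]
  split_ifs with hf
  · rw [Finset.card_insert_of_notMem fun hmem => hk (Finset.mem_of_mem_filter _ hmem)]
  · rw [add_zero]

theorem count_one (f : ℕ+ → Bool) (b : Bool) : count f b 1 = if f 1 = b then 1 else 0 := by
  simp only [count, Finset.Icc_self, Finset.filter_singleton]
  split_ifs <;> rfl

/-- The function with values `g 0, !g 0, g 1, !g 1, …`. -/
def alternate (g : ℕ → Bool) (n : ℕ+) : Bool :=
  if n.natPred % 2 = 0 then g (n.natPred / 2) else !g (n.natPred / 2)

theorem alternate_odd (g : ℕ → Bool) (n : ℕ) : alternate g (2 * n).succPNat = g n := by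
  simp [alternate]

theorem alternate_even (g : ℕ → Bool) (n : ℕ) : alternate g (2 * n + 1).succPNat = !g n := by
  have h₁ : (2 * n + 1) % 2 = 1 := by omega
  have h₂ : (2 * n + 1) / 2 = n := by omega
  simp [alternate, h₁, h₂]

/-- Positions `2 * n + 1` and `2 * n + 2` carry `g n` and its negation, so each such pair adds one
to both counts. -/
theorem count_alternate (g : ℕ → Bool) (n : ℕ) :
    count (alternate g) true (2 * n + 1).succPNat =
      count (alternate g) false (2 * n + 1).succPNat := by
  have hsucc (m : ℕ) : (m + 1).succPNat = m.succPNat + 1 := rfl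
  induction n with
  | zero =>
    have h₁ := alternate_odd g 0
    have h₂ := alternate_even g 0
    change alternate g 1 = g 0 at h₁
    change alternate g (1 + 1) = !g 0 at h₂
    change count _ _ (1 + 1) = count _ _ (1 + 1)
    rw [count_add_one, count_add_one, count_one, count_one, h₁, h₂]
    cases g 0 <;> simp
  | succ n ih =>
    have h₁ := alternate_odd g (n + 1)
    have h₂ := alternate_even g (n + 1)
    have h₀ : (2 * (n + 1)).succPNat = (2 * n + 1).succPNat + 1 := rfl
    rw [hsucc] at h₂ ⊢
    rw [count_add_one, count_add_one, h₂, h₀, count_add_one, count_add_one, ih, ← h₀, h₁]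
    cases g (n + 1) <;> simp

theorem exists_not_computable : ∃ g : ℕ → Bool, g 0 = true ∧ ¬ Computable g := by
  classical
  let h (c : Nat.Partrec.Code) : Bool := decide (c.eval 0).Dom
  -- The halting problem is shifted by one place to free the value at `0`, which becomes `f 1`.
  refine ⟨fun n => n.casesOn true fun m => h (Denumerable.ofNat _ m), rfl, fun hg => ?_⟩
  refine ComputablePred.halting_problem 0 ⟨inferInstance, ?_⟩
  refine (hg.comp (Computable.succ.comp Computable.encode)).of_eq fun c => ?_
  simp [h]

theorem exists_isAdmissible : ∃ f : ℕ+ → Bool, IsAdmissible f := by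
  obtain ⟨g, hg, hcomp⟩ := exists_not_computable
  refine ⟨alternate g, fun hf => hcomp ?_, (alternate_odd g 0).trans hg, fun k hk => ?_⟩
  · have h : Computable fun n : ℕ => (2 * n).succPNat :=
      (primrec_succPNat.comp (Primrec.nat_double)).to_comp
    exact (hf.comp h).of_eq (alternate_odd g)
  · obtain ⟨m, rfl⟩ : ∃ m, k = m + 1 := ⟨k - 1, by omega⟩
    have h : (2 ^ (m + 1) : ℕ+) = (2 * (2 ^ m - 1) + 1).succPNat := by
      have := Nat.one_le_two_pow (n := m)
      apply PNat.eq
      rw [PNat.pow_coe, PNat.val_ofNat, Nat.succPNat_coe, pow_succ]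
      omega
    rw [h]
    exact count_alternate g _

/-! ### Undecidability of the combination -/

/-- The union of the signatures `sigP` and `sigS`. -/
abbrev sigPS : FirstOrder.Language.{0, 0} := sigP.sum sigS

/-- The atomic formula `P_{n + 1}`. -/
def formulaP (n : ℕ) : sigPS.Formula ℕ :=
  (LHom.sumInl : sigP →ᴸ sigPS).onFormula ((symP n.succPNat).formula Fin.elim0)

/-- The formula `s(xᵢ) = xᵢ`. -/
def formulaFix (i : ℕ) : sigPS.Formula ℕ :=
  (LHom.sumInr : sigS →ᴸ sigPS).onFormula ((termS (.var i)).equal (.var i))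

/-- The formula `xᵢ ≠ xⱼ`. -/
def formulaNe (i j : ℕ) : sigPS.Formula ℕ := ∼((Term.var i).equal (.var j))

/-- The conjuncts of `countFormula`. -/
def countConjuncts (n m : ℕ) : List (sigPS.Formula ℕ) :=
  formulaP n :: ((List.range m).map formulaFix ++
    (List.range m).flatMap fun i => (List.range i).map (formulaNe i))

/-- The quantifier-free formula "`P_{n + 1}`, and `x₀, …, x_{m - 1}` are distinct fixed points of
`s`". -/
def countFormula (n m : ℕ) : sigPS.Formula ℕ :=
  ∼((countConjuncts n m).foldr BoundedFormula.imp ⊥)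

theorem isQF_foldr_imp {L : FirstOrder.Language.{0, 0}} {l : List (L.Formula ℕ)}
    (h : ∀ φ ∈ l, φ.IsQF) : (l.foldr BoundedFormula.imp ⊥ : L.Formula ℕ).IsQF := by
  induction l with
  | nil => exact .falsum
  | cons φ l ih =>
    exact (h φ (by simp)).imp (ih fun ψ hψ => h ψ (by simp [hψ]))

theorem isQF_countFormula (n m : ℕ) : (countFormula n m).IsQF := by
  refine BoundedFormula.IsQF.not (isQF_foldr_imp fun φ hφ => ?_)
  simp only [countConjuncts, List.mem_cons, List.mem_append, List.mem_map, List.mem_flatMap] at hφ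
  rcases hφ with rfl | ⟨i, -, rfl⟩ | ⟨i, -, j, -, rfl⟩
  · exact (BoundedFormula.IsAtomic.rel _ _).isQF
  · exact (BoundedFormula.IsAtomic.equal _ _).isQF
  · exact (BoundedFormula.IsAtomic.equal _ _).isQF.not

/-- A negated chain of implications ending in `⊥` is a conjunction, in a form whose Gödel number is
a fold over the codes of the conjuncts. -/
theorem realize_not_foldr_imp {L : FirstOrder.Language.{0, 0}} {A : Type u} [L.Structure A]
    (x : ℕ → A) (l : List (L.Formula ℕ)) :
    Formula.Realize (∼(l.foldr BoundedFormula.imp ⊥)) x ↔ ∀ φ ∈ l, φ.Realize x := by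
  rw [Formula.realize_not]
  induction l with
  | nil => simp
  | cons φ l ih =>
    rw [List.foldr_cons, Formula.realize_imp, Classical.not_imp, ih, List.forall_mem_cons]

section

variable {A : Type u} [sigP.Structure A] [sigS.Structure A] [sigPS.Structure A]
  [(LHom.sumInl : sigP →ᴸ sigPS).IsExpansionOn A] [(LHom.sumInr : sigS →ᴸ sigPS).IsExpansionOn A]

theorem realize_countFormula (x : ℕ → A) (n m : ℕ) :
    (countFormula n m).Realize x ↔ holdsP A n.succPNat ∧ (∀ i < m, x i ∈ fixSet A true) ∧
      ∀ i < m, ∀ j < i, x i ≠ x j := by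
  have hP : (formulaP n).Realize x ↔ holdsP A n.succPNat := by
    rw [formulaP, LHom.realize_onFormula, Formula.realize_rel]
    exact relMap_iff_holdsP _
  have hfix (i : ℕ) : (formulaFix i).Realize x ↔ x i ∈ fixSet A true := by
    rw [formulaFix, LHom.realize_onFormula, Formula.realize_equal, realize_termS, mem_fixSet_true]
    rfl
  have hne (i j : ℕ) : (formulaNe i j).Realize x ↔ x i ≠ x j := by
    rw [formulaNe, Formula.realize_not, Formula.realize_equal]
    rfl
  rw [countFormula, realize_not_foldr_imp]
  simp only [countConjuncts, List.forall_mem_cons, List.forall_mem_append, List.forall_mem_map,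
    List.mem_flatMap, List.mem_range, hP, hfix]
  refine and_congr_right fun _ => and_congr_right fun _ => ?_
  constructor
  · exact fun h i hi j hj => (hne i j).1 (h _ ⟨i, hi, List.mem_map.2 ⟨j, List.mem_range.2 hj, rfl⟩⟩)
  · rintro h _ ⟨i, hi, hj⟩
    obtain ⟨j, hj', rfl⟩ := List.mem_map.1 hj
    exact (hne i j).2 (h i hi j (List.mem_range.1 hj'))

theorem model_combination_iff {T₁ : sigP.Theory} {T₂ : sigS.Theory} :
    A ⊨ combination T₁ T₂ ↔ A ⊨ T₁ ∧ A ⊨ T₂ := by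
  rw [combination, Theory.model_union_iff, LHom.onTheory_model, LHom.onTheory_model]

/-- The predicate fixes the size at `n + 1`. Since the counts at `i` sum to `i`, the model has index
`i = n + 1`, which fixes its number of fixed points. -/
theorem IsAdmissible.le_count_of_realize {f : ℕ+ → Bool} (hf : IsAdmissible f) {n m : ℕ}
    (h₁ : A ⊨ TEq) (h₂ : A ⊨ Tf f) (x : ℕ → A) (h : (countFormula n m).Realize x) :
    m ≤ count f true n.succPNat := by
  obtain ⟨hP, hfix, hne⟩ := (realize_countFormula x n m).1 h
  obtain ⟨e⟩ := model_TEq_iff.1 h₁ _ hP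
  have hcard : ENat.card A = (n.succPNat : ℕ) := by
    rw [ENat.card_congr e, ENat.card_eq_coe_fintype_card, Fintype.card_fin]
  rw [← encard_fixSet_add] at hcard
  rcases hf.model_Tf_iff.1 h₂ with htop | ⟨i, hi⟩
  · rw [htop, htop, top_add] at hcard
    exact absurd hcard.symm (ENat.natCast_ne_top _)
  · rw [hi, hi, ← Nat.cast_add, count_add, Nat.cast_inj] at hcard
    obtain rfl : i = n.succPNat := PNat.eq hcard
    rw [← Nat.cast_le (α := ℕ∞), ← hi true, ← exists_injective_mem_iff]
    refine ⟨fun i => x i, fun i j hij => ?_, fun i => hfix i i.2⟩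
    by_contra hij'
    rcases lt_or_gt_of_ne hij' with hlt | hlt
    · exact hne j j.2 i hlt hij.symm
    · exact hne i i.2 j hlt hij

end

theorem IsAdmissible.satisfiable_countFormula {f : ℕ+ → Bool} (hf : IsAdmissible f) (n m : ℕ) :
    Satisfiable.{u} (combination TEq (Tf f)) (countFormula n m) ↔ m ≤ count f true n.succPNat := by
  constructor
  · rintro ⟨A, S, x, hA, hx⟩
    let _ : sigP.Structure A := (LHom.sumInl : sigP →ᴸ sigPS).reduct A
    let _ : sigS.Structure A := (LHom.sumInr : sigS →ᴸ sigPS).reduct A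
    obtain ⟨h₁, h₂⟩ := model_combination_iff.1 hA
    exact hf.le_count_of_realize h₁ h₂ x hx
  · intro hm
    obtain ⟨B, S, y, hB, -, hcard⟩ : ∃ (B : Type u) (_ : sigS.Structure B) (y : ℕ → B),
        B ⊨ Tf f ∧ (⊤ : sigS.Formula ℕ).Realize y ∧
          #B = ((n.succPNat : ℕ) : Cardinal.{u}) := by
      -- A model of size `n + 1` is grown from a single fixed point; `f 1 = 1` guarantees room for
      -- it.
      let _ : sigS.Structure PUnit.{u + 1} := structureOfMap id
      refine hf.exists_extension_of_count (fun _ => PUnit.unit) BoundedFormula.IsQF.top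
        (Formula.realize_top.2 trivial) _ (Bool.forall_bool.2 ⟨?_, ?_⟩)
      · rw [Set.encard_eq_zero.2 (Set.eq_empty_of_forall_notMem fun y hy =>
          mem_fixSet_false.1 hy (Subsingleton.elim _ _))]
        exact bot_le
      · refine (Set.encard_le_encard (Set.subset_univ _)).trans ?_
        have h : 1 ≤ count f true n.succPNat := by
          refine le_trans ?_ (count_mono f true one_le)
          rw [count_one, hf.map_one, if_pos rfl]
        rw [Set.encard_univ]
        simpa using h
    have hcard' : ENat.card B = (n.succPNat : ℕ) := toENat_eq_natCast.2 hcard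
    rw [← encard_fixSet_add] at hcard'
    have hi : (fixSet B true).encard = count f true n.succPNat := by
      rcases hf.model_Tf_iff.1 hB with htop | ⟨i, hi⟩
      · rw [htop, htop, top_add] at hcard'
        exact absurd hcard'.symm (ENat.natCast_ne_top _)
      · rw [hi, hi, ← Nat.cast_add, count_add, Nat.cast_inj] at hcard'
        rw [hi, PNat.eq hcard']
    obtain ⟨xs, hxs, hfix⟩ := exists_injective_mem_iff.2
      ((Nat.cast_le.2 hm).trans_eq hi.symm)
    -- Only `P_{n + 1}` is made true, so its axiom is the only one with content.
    let _ : sigP.Structure B := structureOfPred B fun k => k = n.succPNat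
    obtain ⟨e⟩ : Nonempty (B ≃ Fin n.succPNat) := by
      have h : #B = #(ULift.{u} (Fin n.succPNat)) := by rw [hcard]; simp
      exact ⟨(Cardinal.eq.1 h).some.trans Equiv.ulift⟩
    refine ⟨B, Language.sumStructure sigP sigS B,
      fun i => if hi : i < m then xs ⟨i, hi⟩ else y 0, model_combination_iff.2 ⟨?_, hB⟩,
      (realize_countFormula _ n m).2 ⟨rfl, fun i hi => ?_, fun i hi j hj => ?_⟩⟩
    · exact model_TEq_iff.2 (by rintro _ rfl; exact ⟨e⟩)
    · rw [dif_pos hi]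
      exact hfix _
    · rw [dif_pos hi, dif_pos (hj.trans hi)]
      exact fun h => hj.ne' (congrArg Fin.val (hxs h))

/-! The Gödel number of `countFormula` is computable. -/

theorem formulaCode_foldr_imp {L : FirstOrder.Language.{0, 0}} [EffectiveSignature L]
    (l : List (L.Formula ℕ)) : formulaCode (l.foldr BoundedFormula.imp ⊥ : L.Formula ℕ) =
      (l.map formulaCode).foldr (fun a r => Nat.pair 3 (Nat.pair a r)) (Nat.pair 0 0) := by
  induction l with
  | nil => rfl
  | cons φ l ih =>
    rw [List.foldr_cons, List.map_cons, List.foldr_cons, ← ih]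
    rfl

/-- The code of the variable with index `i`. -/
def varCode (i : ℕ) : ℕ := Nat.pair 0 (2 * i)

theorem formulaCode_formulaNe (i j : ℕ) : formulaCode (formulaNe i j) =
    Nat.pair 3 (Nat.pair (Nat.pair 1 (Nat.pair (varCode i) (varCode j))) (Nat.pair 0 0)) := rfl

/-- The code `e` of `s` need not be known, only that it does not depend on `i`. -/
theorem formulaCode_formulaFix : ∃ e : ℕ, ∀ i, formulaCode (formulaFix i) =
    Nat.pair 1 (Nat.pair (Nat.pair 1 (Nat.pair e (Nat.pair (varCode i) 0).succ)) (varCode i)) :=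
  ⟨_, fun _ => rfl⟩

/-- `P_{n + 1}` has code `n` in `sigP`, and the left summand of a sum doubles codes. -/
theorem formulaCode_formulaP (n : ℕ) : formulaCode (formulaP n) =
    Nat.pair 2 (Nat.pair (2 * n) 0) := rfl

section

open Primrec

theorem primrec_varCode : Primrec varCode :=
  Primrec₂.natPair.comp (Primrec.const 0) Primrec.nat_double

theorem primrec_formulaCode_countFormula :
    Primrec₂ fun n m => formulaCode (countFormula n m) := by
  have hP : Primrec fun n => formulaCode (formulaP n) :=
    (Primrec₂.natPair.comp (Primrec.const 2) (Primrec₂.natPair.comp Primrec.nat_double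
      (Primrec.const 0))).of_eq fun n => (formulaCode_formulaP n).symm
  have hfix : Primrec fun i => formulaCode (formulaFix i) := by
    obtain ⟨e, he⟩ := formulaCode_formulaFix
    refine Primrec.of_eq ?_ fun i => (he i).symm
    exact Primrec₂.natPair.comp (Primrec.const 1) (Primrec₂.natPair.comp (Primrec₂.natPair.comp
      (Primrec.const 1) (Primrec₂.natPair.comp (Primrec.const e) (Primrec.succ.comp
        (Primrec₂.natPair.comp primrec_varCode (Primrec.const 0))))) primrec_varCode)
  have hne : Primrec₂ fun i j => formulaCode (formulaNe i j) :=
    Primrec.of_eq (Primrec₂.natPair.comp (Primrec.const 3) (Primrec₂.natPair.comp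
      (Primrec₂.natPair.comp (Primrec.const 1) (Primrec₂.natPair.comp (primrec_varCode.comp fst)
        (primrec_varCode.comp snd))) (Primrec.const (Nat.pair 0 0))))
      fun x => (formulaCode_formulaNe x.1 x.2).symm
  have hneList : Primrec fun i => (List.range i).map fun j => formulaCode (formulaNe i j) :=
    Primrec.list_map Primrec.list_range hne
  have hfixList : Primrec fun m => (List.range m).map fun i => formulaCode (formulaFix i) :=
    Primrec.list_map Primrec.list_range (hfix.comp snd)
  have hneAll : Primrec fun m => (List.range m).flatMap fun i =>
      (List.range i).map fun j => formulaCode (formulaNe i j) :=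
    Primrec.list_flatMap Primrec.list_range (hneList.comp snd)
  have hcodes : Primrec₂ fun n m => (countConjuncts n m).map formulaCode := by
    refine Primrec.of_eq (Primrec.list_cons.comp (hP.comp fst)
      (Primrec.list_append.comp (hfixList.comp snd) (hneAll.comp snd))) fun x => ?_
    simp [countConjuncts, List.map_flatMap, Function.comp_def]
  have hstep : Primrec₂ fun (_ : ℕ × ℕ) (y : ℕ × ℕ) => Nat.pair 3 (Nat.pair y.1 y.2) :=
    Primrec₂.natPair.comp (Primrec.const 3)
      (Primrec₂.natPair.comp (fst.comp snd) (snd.comp snd))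
  have hfold := Primrec.list_foldr hcodes (Primrec.const (Nat.pair 0 0)) hstep
  refine Primrec.of_eq (Primrec₂.natPair.comp (Primrec.const 3) (Primrec₂.natPair.comp hfold
    (Primrec.const (Nat.pair 0 0)))) fun x => ?_
  rw [← formulaCode_foldr_imp]
  rfl

end

/-- Once the number of ones among the first `n` values is known, asking whether one more fixed point
is possible in size `n + 1` reveals the next value of `f`, and with it the next count. -/
theorem IsAdmissible.not_isDecidable_combination {f : ℕ+ → Bool} (hf : IsAdmissible f) :
    ¬ IsDecidable.{u} (combination TEq (Tf f)) := by
  rintro ⟨d, hd, hdec⟩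
  apply hf.not_computable
  -- `count` takes positive arguments only; `a` prepends the value `0` to start the recursion.
  let a : ℕ → ℕ := fun n => n.casesOn 0 fun k => count f true k.succPNat
  let F : ℕ → ℕ → Bool := fun n k => d (formulaCode (countFormula n (k + 1)))
  have hstep (n : ℕ) : a (n + 1) = a n + if f n.succPNat = true then 1 else 0 := by
    rcases n with _ | n
    · exact (count_one f true).trans (Nat.zero_add _).symm
    · exact count_add_one f true n.succPNat
  have hF (n : ℕ) : F n (a n) = f n.succPNat := by
    have h := hdec _ (isQF_countFormula n (a n + 1))
    rw [hf.satisfiable_countFormula] at h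
    rw [Bool.eq_iff_iff]
    refine h.trans ?_
    have h' := hstep n
    change count f true n.succPNat = _ at h'
    rw [h']
    split_ifs with hfn <;> simp [hfn]
  have hFc : Computable₂ F := hd.comp (primrec_formulaCode_countFormula.to_comp.comp
    Computable.fst (Computable.succ.comp Computable.snd))
  have ha : Computable a := by
    -- This recursion refers to `d` alone; that it produces `a` is proved afterwards from `hF` and
    -- `hstep`.
    have hrec : Computable fun n : ℕ =>
        (Nat.rec 0 (fun n k => k + cond (F n k) 1 0) n : ℕ) := by
      refine Computable.nat_rec (h := fun _ y => y.2 + cond (F y.1 y.2) 1 0) Computable.id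
        (Computable.const 0) ?_
      have hk : Computable fun x : ℕ × ℕ × ℕ => x.2.2 := Computable.snd.comp Computable.snd
      have hb : Computable fun x : ℕ × ℕ × ℕ => F x.2.1 x.2.2 :=
        hFc.comp (Computable.fst.comp Computable.snd) hk
      exact Primrec.nat_add.to_comp.comp hk
        (Computable.cond hb (Computable.const 1) (Computable.const 0))
    refine hrec.of_eq fun n => ?_
    induction n with
    | zero => rfl
    | succ n ih =>
      change _ + cond (F n _) 1 0 = _
      rw [ih, hF, hstep]
      cases f n.succPNat <;> rfl
  refine ((hFc.comp Computable.id ha).comp primrec_natPred.to_comp).of_eq fun n => ?_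
  exact (hF _).trans (congrArg f n.succPNat_natPred)

end TheoryCombination

theorem mainTheorem6 :
    (∃ (L₁ L₂ : FirstOrder.Language.{0, 0}) (_ : TheoryCombination.EffectiveSignature L₁)
      (_ : TheoryCombination.EffectiveSignature L₂) (T₁ : L₁.Theory) (T₂ : L₂.Theory),
      TheoryCombination.IsDecidable.{u} T₁ ∧ TheoryCombination.IsDecidable.{u} T₂ ∧
      TheoryCombination.IsSmooth.{u} T₂ ∧ TheoryCombination.HasFiniteModelProperty.{u} T₂ ∧
      ¬ TheoryCombination.IsDecidable.{u} (TheoryCombination.combination T₁ T₂)) ∧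
    (∃ f : ℕ+ → Bool, TheoryCombination.IsAdmissible f) ∧
    ∀ f : ℕ+ → Bool, TheoryCombination.IsAdmissible f →
      TheoryCombination.IsDecidable.{u} TheoryCombination.TEq ∧
      TheoryCombination.IsDecidable.{u} (TheoryCombination.Tf f) ∧
      TheoryCombination.IsSmooth.{u} (TheoryCombination.Tf f) ∧
      TheoryCombination.HasFiniteModelProperty.{u} (TheoryCombination.Tf f) ∧
      ¬ TheoryCombination.IsDecidable.{u}
        (TheoryCombination.combination TheoryCombination.TEq (TheoryCombination.Tf f)) := by
  have key := fun f (hf : TheoryCombination.IsAdmissible f) =>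
    (⟨TheoryCombination.isDecidable_TEq.{u}, hf.isDecidable_Tf, hf.isSmooth,
      hf.hasFiniteModelProperty, hf.not_isDecidable_combination⟩ : _ ∧ _ ∧ _ ∧ _ ∧ _)
  obtain ⟨f, hf⟩ := TheoryCombination.exists_isAdmissible
  exact ⟨⟨TheoryCombination.sigP, TheoryCombination.sigS, inferInstance, inferInstance,
    TheoryCombination.TEq, TheoryCombination.Tf f, key f hf⟩, ⟨f, hf⟩, key⟩
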